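/- Let $p\ge 1$. A $p\times p$ matrix $G(z)$ of rational functions over $\mathbb C$ is called lossless if, at every point of analyticity $z\in\mathbb C$ of $G$, one has $G(z)^*G(z)\le I_p$ if $|z|>1$, $G(z)^*G(z)=I_p$ if $|z|=1$, and $G(z)^*G(z)\ge I_p$ if $|z|<1$. Let $\mathcal L^p$ be the set of all such functions. For unitary matrices $U,V\in\mathbb C^{(p+1)\times(p+1)}$ let $$\mathcal F_{U,V}(G)(z)=F_1(z)+\frac{F_2(z)F_3(z)}{z-F_4(z)},\qquad \begin{bmatrix}F_1(z)&F_2(z)\\F_3(z)&F_4(z)\end{bmatrix}=V\begin{bmatrix}1&0\\0&G(z)\end{bmatrix}U^*,$$ with $F_1$ of size $p\times p$ and $F_4$ scalar. Let $k_U$ and $k_V$ denote the scalar entries in the last row and the first column of $U$ and $V$, i.e. $U=\begin{bmatrix}\alpha_U&M_U\\k_U&\beta_U^*\end{bmatrix}$ with $M_U$ of size $p\times p$, and similarly for $V$. For an invertible rational $2p\times 2p$ matrix function $\Theta=\begin{bmatrix}\Theta_1&\Theta_2\\\Theta_3&\Theta_4\end{bmatrix}$ with $p\times p$ blocks let $\mathcal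 T_\Theta(G)=(\Theta_4G+\Theta_3)(\Theta_2G+\Theta_1)^{-1}$, defined for those $G$ for which $\Theta_2G+\Theta_1$ is invertible as a rational matrix. We say that $\mathcal F_{U,V}$ can be represented as $\mathcal T_\Theta$ if for every $G\in\mathcal L^p$ the matrix $\Theta_2G+\Theta_1$ is invertible and $\mathcal F_{U,V}(G)=\mathcal T_\Theta(G)$. Let $J=\begin{bmatrix}I_p&0\\0&-I_p\end{bmatrix}$, $K=\begin{bmatrix}0&I_p\\I_p&0\end{bmatrix}$ and $b_w(z)=\dfrac{z-w}{1-\overline wz}$. For $u,v\in\mathbb C^p$ with $\|u\|=1$ and $\|v\|<1$ (Euclidean norms), $w,\xi\in\mathbb C$ with $|w|<1$ and $|\xi|=1$, and a constant $J$-unitary matrix $H\in\mathbb C^{2p\times 2p}$ (that is, $H^*JH=J$), put $$\Theta(u,v,w,\xi,H)(z)=\left(I_{2p}+\left(\frac{b_w(z)}{b_w(\xi)}-1\right)\frac{\begin{bmatrix}u\\v\end{bmatrix}\begin{bmatrix}u\\v\end{bmatrix}^*J}{1-\|v\|^2}\right)H,\qquad \Theta^o(z)=K\,\Theta(z^{-1})\,K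 .$$ Let $U,V$ be unitary matrices of size $(p+1)\times(p+1)$. (a) If $p>1$, then $\mathcal F_{U,V}$ can be represented as $\mathcal T_{\Theta(u,v,w,\xi,H)}$ for some parameters $u,v,w,\xi,H$ as above if and only if $|k_U|<|k_V|$, and it can be represented as $\mathcal T_{\Theta(u,v,w,\xi,H)^o}$ for some such parameters if and only if $|k_U|>|k_V|$. (b) If $p=1$, then $\mathcal F_{U,V}$ can be represented as $\mathcal T_{\Theta(u,v,w,\xi,H)}$ for some such parameters if and only if it can be represented as $\mathcal T_{\Theta(u,v,w,\xi,H)^o}$ for some such parameters, and this holds if and only if $|k_U|\neq|k_V|$. -/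

import Mathlib

open Matrix
open scoped ComplexOrder

namespace AllPass

noncomputable section

/-- A `p × q` matrix of rational functions of one complex variable. -/
abbrev RatMat (m n : Type*) : Type _ := Matrix m n (RatFunc ℂ)

/-- Constant matrices, regarded as rational matrix functions. -/
def constMat {m n : Type*} (A : Matrix m n ℂ) : RatMat m n :=
  A.map (RatFunc.C : ℂ →+* RatFunc ℂ)

/-- `z` is a point of analyticity of `R`: no entry of `R`, written in lowest terms, has a pole
at `z`. -/
def AnalyticPoint {m n : Type*} (R : RatMat m n) (z : ℂ) : Prop :=
  ∀ i j, (R i j).denom.eval z ≠ 0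

/-- The value `R(z)` (used at points of analyticity only). -/
def evalMat {m n : Type*} (R : RatMat m n) (z : ℂ) : Matrix m n ℂ :=
  R.map fun r => RatFunc.eval (RingHom.id ℂ) z r

/-- `Θ` is `S`-inner: at all points of analyticity `z`, `Θ(z)* S Θ(z) ≤ S` for `|z| < 1`,
`= S` for `|z| = 1`, and `≥ S` for `|z| > 1`, in the order of Hermitian matrices. -/
def IsInner {k : Type*} [Fintype k] (S : Matrix k k ℂ) (Θ : RatMat k k) : Prop :=
  ∀ z : ℂ, AnalyticPoint Θ z →
    (‖z‖ < 1 → (S - (evalMat Θ z)ᴴ * S * evalMat Θ z).PosSemidef) ∧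
    (‖z‖ = 1 → (evalMat Θ z)ᴴ * S * evalMat Θ z = S) ∧
    (1 < ‖z‖ → ((evalMat Θ z)ᴴ * S * evalMat Θ z - S).PosSemidef)

/-- `G` is lossless (discrete-time stable all-pass): it is `(-I)`-inner. -/
def IsLossless {p : ℕ} (G : RatMat (Fin p) (Fin p)) : Prop :=
  IsInner (-1 : Matrix (Fin p) (Fin p) ℂ) G

/-- The block diagonal matrix `diag(1, G)` of size `p + 1`. -/
def oneDiag {p : ℕ} (G : RatMat (Fin p) (Fin p)) : RatMat (Fin (p + 1)) (Fin (p + 1)) :=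
  Matrix.of fun i j =>
    Fin.cases (Fin.cases 1 (fun _ => 0) j) (fun i' => Fin.cases 0 (fun j' => G i' j') j) i

/-- The matrix function `F(z) = V diag(1, G(z)) U*`. -/
def matF {p : ℕ} (U V : Matrix (Fin (p + 1)) (Fin (p + 1)) ℂ) (G : RatMat (Fin p) (Fin p)) :
    RatMat (Fin (p + 1)) (Fin (p + 1)) :=
  constMat V * oneDiag G * constMat Uᴴ

/-- The mapping `F_{U,V} : G ↦ F₁ + F₂ F₃ / (z - F₄)`, where `F = [F₁, F₂; F₃, F₄]` with `F₁` of
size `p × p` and `F₄` scalar. -/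
def FUV {p : ℕ} (U V : Matrix (Fin (p + 1)) (Fin (p + 1)) ℂ) (G : RatMat (Fin p) (Fin p)) :
    RatMat (Fin p) (Fin p) :=
  Matrix.of fun i j =>
    matF U V G i.castSucc j.castSucc +
      matF U V G i.castSucc (Fin.last p) * matF U V G (Fin.last p) j.castSucc /
        (RatFunc.X - matF U V G (Fin.last p) (Fin.last p))

/-- The scalar `k_U` of the partition `U = [α_U, M_U; k_U, β_U*]`, where `α_U` is `p × 1` and
`M_U` is `p × p`: the entry in the last row and the first column. -/
def kEntry {p : ℕ} (U : Matrix (Fin (p + 1)) (Fin (p + 1)) ℂ) : ℂ := U (Fin.last p) 0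

/-- `G` lies in the domain of `T_Θ`: `Θ₂ G + Θ₁` has full rank `p`. -/
def InLFTDomain {p : ℕ} (Θ : RatMat (Fin p ⊕ Fin p) (Fin p ⊕ Fin p))
    (G : RatMat (Fin p) (Fin p)) : Prop :=
  IsUnit (Θ.toBlocks₁₂ * G + Θ.toBlocks₁₁)

/-- The linear fractional transformation `T_Θ(G) = (Θ₄ G + Θ₃) (Θ₂ G + Θ₁)⁻¹`. -/
def LFT {p : ℕ} (Θ : RatMat (Fin p ⊕ Fin p) (Fin p ⊕ Fin p)) (G : RatMat (Fin p) (Fin p)) :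
    RatMat (Fin p) (Fin p) :=
  (Θ.toBlocks₂₂ * G + Θ.toBlocks₂₁) * (Θ.toBlocks₁₂ * G + Θ.toBlocks₁₁)⁻¹

/-- A mapping `F` coincides with `T_Θ` on the set of `p × p` lossless functions. -/
def RepresentedBy {p : ℕ} (F : RatMat (Fin p) (Fin p) → RatMat (Fin p) (Fin p))
    (Θ : RatMat (Fin p ⊕ Fin p) (Fin p ⊕ Fin p)) : Prop :=
  ∀ G : RatMat (Fin p) (Fin p), IsLossless G → InLFTDomain Θ G ∧ F G = LFT Θ G

/-- The signature matrix `J = diag(I_p, -I_p)`. -/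
def sigJ (p : ℕ) : Matrix (Fin p ⊕ Fin p) (Fin p ⊕ Fin p) ℂ := Matrix.fromBlocks 1 0 0 (-1)

/-- Constant `J`-unitary matrices. -/
def IsJUnitary {p : ℕ} (H : Matrix (Fin p ⊕ Fin p) (Fin p ⊕ Fin p) ℂ) : Prop :=
  Hᴴ * sigJ p * H = sigJ p

/-- The Blaschke factor `b_w(z) = (z - w) / (1 - w̄ z)` as a rational function. -/
def blaschke (w : ℂ) : RatFunc ℂ :=
  (RatFunc.X - RatFunc.C w) / (1 - RatFunc.C (star w) * RatFunc.X)

/-- The value `b_w(ξ)` of the Blaschke factor. -/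
def blaschkeAt (w ξ : ℂ) : ℂ := (ξ - w) / (1 - star w * ξ)

/-- The column vector `[u; v]`. -/
def stack {p : ℕ} (u v : EuclideanSpace ℂ (Fin p)) : Fin p ⊕ Fin p → ℂ :=
  Sum.elim (fun i => u i) (fun i => v i)

/-- The matrix function
`Θ(u,v,w,ξ,H)(z) = (I + (b_w(z) / b_w(ξ) - 1) x x* J / (1 - ‖v‖²)) H` with `x = [u; v]`. -/
def Theta {p : ℕ} (u v : EuclideanSpace ℂ (Fin p)) (w ξ : ℂ)
    (H : Matrix (Fin p ⊕ Fin p) (Fin p ⊕ Fin p) ℂ) : RatMat (Fin p ⊕ Fin p) (Fin p ⊕ Fin p) :=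
  (1 + (blaschke w / RatFunc.C (blaschkeAt w ξ) - 1) •
      constMat ((1 - (‖v‖ : ℂ) ^ 2)⁻¹ •
        (Matrix.vecMulVec (stack u v) (star (stack u v)) * sigJ p))) *
    constMat H

/-- The conditions on the parameters `u, v, w, ξ, H` of `Θ(u,v,w,ξ,H)`. -/
structure IsThetaParam {p : ℕ} (u v : EuclideanSpace ℂ (Fin p)) (w ξ : ℂ)
    (H : Matrix (Fin p ⊕ Fin p) (Fin p ⊕ Fin p) ℂ) : Prop where
  norm_w : ‖w‖ < 1
  norm_u : ‖u‖ = 1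
  norm_v : ‖v‖ < 1
  norm_xi : ‖ξ‖ = 1
  junitary : IsJUnitary H

/-- Substitution of `z⁻¹` for the variable of a rational function. -/
def substInv (r : RatFunc ℂ) : RatFunc ℂ :=
  RatFunc.eval (RatFunc.C : ℂ →+* RatFunc ℂ) (RatFunc.X : RatFunc ℂ)⁻¹ r

/-- The matrix `K = [0, I_p; I_p, 0]`. -/
def swapK (p : ℕ) : RatMat (Fin p ⊕ Fin p) (Fin p ⊕ Fin p) := Matrix.fromBlocks 0 1 1 0

/-- The function `Θ°(z) = K Θ(z⁻¹) K`. -/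
def circ {p : ℕ} (Θ : RatMat (Fin p ⊕ Fin p) (Fin p ⊕ Fin p)) :
    RatMat (Fin p ⊕ Fin p) (Fin p ⊕ Fin p) :=
  swapK p * Θ.map substInv * swapK p

/-- `F` can be represented in the form `T_{Θ(u,v,w,ξ,H)}`. -/
def HasThetaRep {p : ℕ} (F : RatMat (Fin p) (Fin p) → RatMat (Fin p) (Fin p)) : Prop :=
  ∃ (u v : EuclideanSpace ℂ (Fin p)) (w ξ : ℂ) (H : Matrix (Fin p ⊕ Fin p) (Fin p ⊕ Fin p) ℂ),
    IsThetaParam u v w ξ H ∧ RepresentedBy F (Theta u v w ξ H)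

/-- `F` can be represented in the form `T_{Θ(u,v,w,ξ,H)°}`. -/
def HasThetaCircRep {p : ℕ} (F : RatMat (Fin p) (Fin p) → RatMat (Fin p) (Fin p)) : Prop :=
  ∃ (u v : EuclideanSpace ℂ (Fin p)) (w ξ : ℂ) (H : Matrix (Fin p ⊕ Fin p) (Fin p ⊕ Fin p) ℂ),
    IsThetaParam u v w ξ H ∧ RepresentedBy F (circ (Theta u v w ξ H))

end

end AllPass

/-! Write `β_U`, `β_V` here for the rows of `U`, `V` to the right of `k_U`, `k_V`. If `k_U`, `k_V`
are not both zero, eliminating the first coordinate shows that `FUV U V` is the linear fractional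
map of the explicit matrix `chainMat U V = diag(M_U, M_V) + [α_U; α_V] [-z β_U, β_V] / (z k_U -
k_V)` (`representedBy_chainMat`). If both vanish, `α_V* F(G) = α_U*` for every `G`, a linear
constraint incompatible with any invertible `Θ` (`not_representedBy_of_kEntry_eq_zero`).

An invertible `Θ` is determined by its values on lossless functions up to a scalar rational factor
(`eq_smul_of_representedBy`); constant unitary `G` suffice as tests. The question is therefore when
`chainMat U V = φ • Theta u v w ξ H`. The second kind of representation reduces to the first with
`U` and `V` exchanged, because `circ (chainMat U V) = chainMat V U`.

If `|k_U| < |k_V|`, the chain matrix is itself an elementary factor: its value at `1` is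
`J`-unitary, the possible pole `k_V / k_U` lies outside the closed disc, and `[α_U; α_V]` has
positive `J`-norm `|k_V|² - |k_U|²` (`exists_Theta_eq_chainMat`).

Conversely, for `p > 1` some nonzero constant row kills the rank one parts of both sides, so `φ` is
constant; comparing poles gives `k_U = w̄ k_V` with `|w| < 1`. For `p = 1` the factor `φ` may be
nonconstant. The complement of a rank one projection then again has rank one, so `circ` preserves
elementary factors up to scalars, and both kinds of representation coincide. Only `|k_U| = |k_V| ≠
0` remains to be excluded: `det (chainMat U V)` is then constant, whereas `φ² b_w` has odd order at
`w`. -/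

namespace AllPass

open RatFunc (C X)

/-! ### Values of rational functions -/

/-- `r` is analytic at `z` and takes the value `a` there. -/
def HasValue (r : RatFunc ℂ) (z a : ℂ) : Prop :=
  r.denom.eval z ≠ 0 ∧ RatFunc.eval (RingHom.id ℂ) z r = a

namespace HasValue

variable {r s : RatFunc ℂ} {z a b : ℂ}

theorem unique (h : HasValue r z a) (h' : HasValue r z b) : a = b :=
  h.2.symm.trans h'.2

theorem const (z a : ℂ) : HasValue (C a) z a := by
  simp [HasValue]

theorem var (z : ℂ) : HasValue X z z := by
  simp [HasValue]

theorem add (h : HasValue r z a) (h' : HasValue s z b) : HasValue (r + s) z (a + b) := by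
  refine ⟨fun h0 => ?_, ?_⟩
  · have h1 := Polynomial.eval_eq_zero_of_dvd_of_eval_eq_zero (RatFunc.denom_add_dvd r s) h0
    rw [Polynomial.eval_mul] at h1
    exact (mul_ne_zero h.1 h'.1) h1
  · rw [RatFunc.eval_add _ _ (by simpa [← Polynomial.eval₂_id] using h.1)
      (by simpa [← Polynomial.eval₂_id] using h'.1), h.2, h'.2]

theorem mul (h : HasValue r z a) (h' : HasValue s z b) : HasValue (r * s) z (a * b) := by
  refine ⟨fun h0 => ?_, ?_⟩
  · have h1 := Polynomial.eval_eq_zero_of_dvd_of_eval_eq_zero (RatFunc.denom_mul_dvd r s) h0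
    rw [Polynomial.eval_mul] at h1
    exact (mul_ne_zero h.1 h'.1) h1
  · rw [RatFunc.eval_mul _ _ (by simpa [← Polynomial.eval₂_id] using h.1)
      (by simpa [← Polynomial.eval₂_id] using h'.1), h.2, h'.2]

theorem sum {ι : Type*} (t : Finset ι) {f : ι → RatFunc ℂ} {g : ι → ℂ}
    (h : ∀ i, HasValue (f i) z (g i)) : HasValue (∑ i ∈ t, f i) z (∑ i ∈ t, g i) := by
  classical
  induction t using Finset.induction_on with
  | empty => simpa using const z 0
  | insert i t hi ih =>
    rw [Finset.sum_insert hi, Finset.sum_insert hi]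
    exact (h i).add ih

end HasValue

theorem exists_analyticPoint_one_lt_norm {m n : Type*} [Finite m] [Finite n] (R : RatMat m n) :
    ∃ z : ℂ, 1 < ‖z‖ ∧ AnalyticPoint R z := by
  have hfin : {z : ℂ | ∃ i j, (R i j).denom.eval z = 0}.Finite := by
    have : {z : ℂ | ∃ i j, (R i j).denom.eval z = 0} =
        ⋃ i, ⋃ j, {z : ℂ | (R i j).denom.IsRoot z} := by
      ext z; simp [Polynomial.IsRoot]
    rw [this]
    exact Set.finite_iUnion fun i => Set.finite_iUnion fun j =>
      Polynomial.finite_setOfPred_isRoot (RatFunc.denom_ne_zero _)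
  have hinf : {z : ℂ | 1 < ‖z‖}.Infinite := by
    refine Set.infinite_of_injective_forall_mem (f := fun n : ℕ => ((n : ℂ) + 2)) ?_ ?_
    · intro a b h
      simpa using h
    · intro n
      have : ((n : ℂ) + 2) = ((n + 2 : ℕ) : ℂ) := by push_cast; ring
      simp only [Set.mem_ofPred_eq, this, Complex.norm_natCast]
      exact_mod_cast (by omega : 1 < n + 2)
  obtain ⟨z, hz, hz'⟩ := (hinf.sdiff hfin).nonempty
  refine ⟨z, hz, fun i j h => hz' ⟨i, j, h⟩⟩

/-! ### Lossless functions -/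

theorem evalMat_constMat {m n : Type*} (A : Matrix m n ℂ) (z : ℂ) :
    evalMat (constMat A) z = A := by
  ext i j
  simp [evalMat, constMat]

theorem isLossless_constMat {p : ℕ} {A : Matrix (Fin p) (Fin p) ℂ} (hA : Aᴴ * A = 1) :
    IsLossless (constMat A) := by
  intro z _
  simp [evalMat_constMat, hA, Matrix.PosSemidef.zero]

/-- Being `(-I)`-inner means `A* A ≤ I` at points outside the closed disc, so a lossless function is
contractive there. -/
theorem sum_norm_sq_mulVec_le {m : Type*} [Fintype m] [DecidableEq m] {A : Matrix m m ℂ}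
    (hA : (Aᴴ * (-1) * A - (-1)).PosSemidef) (x : m → ℂ) :
    ∑ i, ‖(A *ᵥ x) i‖ ^ 2 ≤ ∑ i, ‖x i‖ ^ 2 := by
  have h := hA.dotProduct_mulVec_nonneg x
  have key : star x ⬝ᵥ (Aᴴ * (-1) * A - (-1)) *ᵥ x
      = ((∑ i, ‖x i‖ ^ 2 - ∑ i, ‖(A *ᵥ x) i‖ ^ 2 : ℝ) : ℂ) := by
    have e : ∀ y : m → ℂ, star y ⬝ᵥ y = ((∑ i, ‖y i‖ ^ 2 : ℝ) : ℂ) := by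
      intro y
      simp only [dotProduct, Pi.star_apply, RCLike.star_def, Complex.conj_mul']
      push_cast; rfl
    have e1 : Aᴴ * (-1) * A - (-1) = 1 - Aᴴ * A := by
      simp only [Matrix.mul_neg, Matrix.mul_one, Matrix.neg_mul]; abel
    rw [e1, Matrix.sub_mulVec, Matrix.one_mulVec, dotProduct_sub, e, ← Matrix.mulVec_mulVec,
      Matrix.dotProduct_mulVec, ← Matrix.star_mulVec, e]
    push_cast; rfl
  rw [key] at h
  have := Complex.zero_le_real.1 h
  linarith

theorem norm_sum_mul_le_one {n : Type*} [Fintype n] {a b : n → ℂ}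
    (ha : ∑ i, ‖a i‖ ^ 2 ≤ 1) (hb : ∑ i, ‖b i‖ ^ 2 ≤ 1) : ‖∑ i, a i * b i‖ ≤ 1 := by
  have h1 : ‖∑ i, a i * b i‖ ≤ ∑ i, ‖a i‖ * ‖b i‖ :=
    (norm_sum_le _ _).trans_eq (by simp)
  have h2 := Finset.sum_mul_sq_le_sq_mul_sq Finset.univ (fun i => ‖a i‖) (fun i => ‖b i‖)
  have h3 : (∑ i, ‖a i‖ ^ 2) * ∑ i, ‖b i‖ ^ 2 ≤ 1 :=
    mul_le_one₀ ha (by positivity) hb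
  have h4 : (∑ i, ‖a i‖ * ‖b i‖) ^ 2 ≤ 1 := h2.trans h3
  have h5 : 0 ≤ ∑ i, ‖a i‖ * ‖b i‖ := by positivity
  nlinarith

theorem sum_norm_sq_row {n : Type*} [Fintype n] [DecidableEq n] {U : Matrix n n ℂ}
    (hU : U ∈ Matrix.unitaryGroup n ℂ) (i : n) : ∑ j, ‖U i j‖ ^ 2 = 1 := by
  have h := congrFun (congrFun (Matrix.mem_unitaryGroup_iff.1 hU) i) i
  simp only [Matrix.mul_apply, Matrix.star_apply, RCLike.star_def, Complex.mul_conj',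
    Matrix.one_apply_eq] at h
  exact_mod_cast h

/-- The scalar entry `F₄` is not the variable, so that `z - F₄` is invertible. -/
theorem X_sub_matF_ne_zero {p : ℕ} {U V : Matrix (Fin (p + 1)) (Fin (p + 1)) ℂ}
    (hU : U ∈ Matrix.unitaryGroup (Fin (p + 1)) ℂ)
    (hV : V ∈ Matrix.unitaryGroup (Fin (p + 1)) ℂ)
    {G : RatMat (Fin p) (Fin p)} (hG : IsLossless G) :
    X - matF U V G (Fin.last p) (Fin.last p) ≠ 0 := by
  intro h0
  -- At such a point `diag(1, G(z))` is a contraction, hence `|F₄(z)| ≤ 1 < |z|` by Cauchy–Schwarz.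
  -- Below, `f` is the last column of `U*` and `g` its image under `diag(1, G(z))`.
  obtain ⟨z, hz, ha⟩ := exists_analyticPoint_one_lt_norm G
  have hpos := (hG z ha).2.2 hz
  set f : Fin (p + 1) → ℂ := fun j => star (U (Fin.last p) j) with hf
  set g : Fin (p + 1) → ℂ :=
    Fin.cons (f 0) (evalMat G z *ᵥ fun j => f j.succ) with hg
  have hval : HasValue (matF U V G (Fin.last p) (Fin.last p)) z
      (∑ i, V (Fin.last p) i * g i) := by
    have e : matF U V G (Fin.last p) (Fin.last p) =
        ∑ i, C (V (Fin.last p) i) * (Fin.cons (C (f 0)) (fun i => ∑ j, G i j * C (f j.succ)) :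
          Fin (p + 1) → RatFunc ℂ) i := by
      rw [matF, Matrix.mul_assoc, Matrix.mul_apply]
      refine Finset.sum_congr rfl fun i _ => ?_
      congr 1
      rw [Matrix.mul_apply, Fin.sum_univ_succ]
      refine Fin.cases ?_ (fun i => ?_) i
      · simp [oneDiag, constMat, hf]
      · simp [oneDiag, constMat, hf]
    rw [e]
    refine HasValue.sum _ fun i => (HasValue.const _ _).mul ?_
    refine Fin.cases ?_ (fun i => ?_) i
    · exact HasValue.const _ _
    · simp only [hg, Fin.cons_succ, Matrix.mulVec, dotProduct]
      exact HasValue.sum _ fun j => HasValue.mul ⟨ha i j, rfl⟩ (HasValue.const _ _)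
  rw [← sub_eq_zero.1 h0] at hval
  have hz1 : z = ∑ i, V (Fin.last p) i * g i := (HasValue.var z).unique hval
  have hfn : ∑ i, ‖f i‖ ^ 2 = 1 := by
    simpa [hf] using sum_norm_sq_row hU (Fin.last p)
  have hgn : ∑ i, ‖g i‖ ^ 2 ≤ 1 := by
    rw [← hfn, Fin.sum_univ_succ, Fin.sum_univ_succ (f := fun i => ‖f i‖ ^ 2)]
    simp only [hg, Fin.cons_zero, Fin.cons_succ]
    exact (add_le_add_iff_left _).2 (sum_norm_sq_mulVec_le hpos _)
  have := norm_sum_mul_le_one (sum_norm_sq_row hV (Fin.last p)).le hgn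
  rw [← hz1] at this
  linarith

/-! ### Substitution of the inverse of the variable -/

/-- Up to a power of `X`, `q(1/X)` is the reversed polynomial. This is what lets the substitution
extend to a ring homomorphism of the whole field. -/
theorem eval₂_X_inv_ne_zero {q : Polynomial ℂ} (hq : q ≠ 0) :
    q.eval₂ (C : ℂ →+* RatFunc ℂ) (X : RatFunc ℂ)⁻¹ ≠ 0 := by
  intro h
  have : Invertible (X : RatFunc ℂ)⁻¹ := invertibleOfNonzero (inv_ne_zero RatFunc.X_ne_zero)
  rw [← Polynomial.eval₂_reverse_eq_zero_iff, invOf_eq_inv, inv_inv] at h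
  have h1 : algebraMap (Polynomial ℂ) (RatFunc ℂ) q.reverse = 0 := by
    rw [← RatFunc.aeval_X_left_eq_algebraMap, Polynomial.aeval_def]
    exact h
  rw [map_eq_zero_iff _ (RatFunc.algebraMap_injective ℂ), Polynomial.reverse_eq_zero] at h1
  exact hq h1

theorem nonZeroDivisors_le_comap_eval₂_X_inv :
    nonZeroDivisors (Polynomial ℂ) ≤ (nonZeroDivisors (RatFunc ℂ)).comap
      (Polynomial.eval₂RingHom (C : ℂ →+* RatFunc ℂ) (X : RatFunc ℂ)⁻¹) :=
  fun _ hq => mem_nonZeroDivisors_of_ne_zero (eval₂_X_inv_ne_zero (nonZeroDivisors.ne_zero hq))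

/-- `substInv` as a ring homomorphism. -/
noncomputable def substInvHom : RatFunc ℂ →+* RatFunc ℂ :=
  RatFunc.liftRingHom (Polynomial.eval₂RingHom (C : ℂ →+* RatFunc ℂ) (X : RatFunc ℂ)⁻¹)
    nonZeroDivisors_le_comap_eval₂_X_inv

theorem substInv_eq (r : RatFunc ℂ) : substInv r = substInvHom r := by
  rw [substInvHom, RatFunc.liftRingHom_apply]
  rfl

@[simp]
theorem substInvHom_C (a : ℂ) : substInvHom (C a) = C a := by
  simp [substInvHom]

@[simp]
theorem substInvHom_X : substInvHom X = X⁻¹ := by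
  simp [substInvHom]

@[simp]
theorem substInvHom_substInvHom (r : RatFunc ℂ) : substInvHom (substInvHom r) = r := by
  have h : substInvHom.comp substInvHom = RingHom.id _ := by
    apply IsFractionRing.ringHom_ext (A := Polynomial ℂ)
    intro q
    induction q using Polynomial.induction_on' with
    | add p q hp hq => rw [map_add, map_add, hp, hq, map_add]
    | monomial n a => simp
  exact RingHom.congr_fun h r

/-! ### The involution `circ` -/

section circ

variable {p : ℕ} (Θ Ψ : RatMat (Fin p ⊕ Fin p) (Fin p ⊕ Fin p))

/-- Conjugation by `K` only relabels indices, so `circ` inherits multiplicativity and involutivity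
from `substInvHom` and `Sum.swap`. -/
theorem circ_apply (i j : Fin p ⊕ Fin p) : circ Θ i j = substInvHom (Θ i.swap j.swap) := by
  rw [circ, swapK, ← Matrix.fromBlocks_toBlocks (Θ.map substInv)]
  rcases i with i | i <;> rcases j with j | j <;>
    simp [Matrix.fromBlocks_multiply, Matrix.toBlocks₁₁, Matrix.toBlocks₁₂, Matrix.toBlocks₂₁,
      Matrix.toBlocks₂₂, substInv_eq]

theorem circ_circ : circ (circ Θ) = Θ := by
  ext i j
  simp [circ_apply]

theorem circ_smul (φ : RatFunc ℂ) : circ (φ • Θ) = substInvHom φ • circ Θ := by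
  ext i j
  simp [circ_apply]

theorem circ_mul : circ (Θ * Ψ) = circ Θ * circ Ψ := by
  ext i j
  simp only [circ_apply, Matrix.mul_apply, map_sum, map_mul]
  exact Fintype.sum_equiv (Equiv.sumComm _ _) _ _ fun x => by simp

theorem circ_one : circ (1 : RatMat (Fin p ⊕ Fin p) (Fin p ⊕ Fin p)) = 1 := by
  ext i j
  simp [circ_apply, Matrix.one_apply, apply_ite, Sum.swap_leftInverse.injective.eq_iff]

theorem isUnit_circ {Θ : RatMat (Fin p ⊕ Fin p) (Fin p ⊕ Fin p)} (h : IsUnit Θ) :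
    IsUnit (circ Θ) := by
  obtain ⟨Ξ, h1, h2⟩ := isUnit_iff_exists.1 h
  exact isUnit_iff_exists.2 ⟨circ Ξ, by rw [← circ_mul, h1, circ_one],
    by rw [← circ_mul, h2, circ_one]⟩

end circ

/-! ### The chain matrix of `FUV` -/

section chainMat

variable {p : ℕ} (U V : Matrix (Fin (p + 1)) (Fin (p + 1)) ℂ)

/-- The vector `[α_U; α_V]`. -/
def chainCol : Fin p ⊕ Fin p → ℂ :=
  Sum.elim (fun i => U i.castSucc 0) (fun i => V i.castSucc 0)

/-- The scalar polynomial `z k_U - k_V`. -/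
noncomputable def chainDenom : RatFunc ℂ := X * C (kEntry U) - C (kEntry V)

/-- The row `[-z β_U*, β_V*] / (z k_U - k_V)`. -/
noncomputable def chainRow : Fin p ⊕ Fin p → RatFunc ℂ :=
  Sum.elim (fun j => -(X * C (U (Fin.last p) j.succ)) / chainDenom U V)
    (fun j => C (V (Fin.last p) j.succ) / chainDenom U V)

/-- The block diagonal matrix `diag(M_U, M_V)`. -/
def chainConst : Matrix (Fin p ⊕ Fin p) (Fin p ⊕ Fin p) ℂ :=
  Matrix.fromBlocks (Matrix.of fun i j => U i.castSucc j.succ) 0 0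
    (Matrix.of fun i j => V i.castSucc j.succ)

/-- The rational matrix function `Θ` for which `FUV U V = LFT Θ`, if `z k_U - k_V` is not zero. -/
noncomputable def chainMat : RatMat (Fin p ⊕ Fin p) (Fin p ⊕ Fin p) :=
  constMat (chainConst U V) + Matrix.vecMulVec (C ∘ chainCol U V) (chainRow U V)

theorem chainMat_apply (i j : Fin p ⊕ Fin p) :
    chainMat U V i j = C (chainConst U V i j) + C (chainCol U V i) * chainRow U V j := by
  simp [chainMat, constMat, Matrix.vecMulVec_apply]

variable {U V}

theorem eq_zero_of_C_mul_X_add_C {a b : ℂ} (h : X * C a - C b = 0) : a = 0 ∧ b = 0 := by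
  have h1 : algebraMap (Polynomial ℂ) (RatFunc ℂ)
      (Polynomial.X * Polynomial.C a - Polynomial.C b) = 0 := by
    rwa [map_sub, map_mul, RatFunc.algebraMap_X, RatFunc.algebraMap_C, RatFunc.algebraMap_C]
  rw [map_eq_zero_iff _ (RatFunc.algebraMap_injective ℂ)] at h1
  have e0 := congrArg (Polynomial.eval 0) h1
  have e1 := congrArg (Polynomial.eval 1) h1
  simp only [Polynomial.eval_sub, Polynomial.eval_mul, Polynomial.eval_X, Polynomial.eval_C,
    Polynomial.eval_zero] at e0 e1
  have hb : b = 0 := by linear_combination -e0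
  exact ⟨by linear_combination e1 + hb, hb⟩

theorem chainDenom_ne_zero (h : ¬(kEntry U = 0 ∧ kEntry V = 0)) : chainDenom U V ≠ 0 :=
  fun h0 => h (eq_zero_of_C_mul_X_add_C h0)

/-- In coordinates, `U [C; I] = [A; S]`, `V [C; G] = [Y; z S]` implies `F_{U,V}(G) A = Y`. -/
theorem representedBy_chainMat (hU : U ∈ Matrix.unitaryGroup (Fin (p + 1)) ℂ)
    (hV : V ∈ Matrix.unitaryGroup (Fin (p + 1)) ℂ) (hk : ¬(kEntry U = 0 ∧ kEntry V = 0)) :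
    RepresentedBy (FUV U V) (chainMat U V) := by
  intro G hG
  have hF := X_sub_matF_ne_zero hU hV hG
  have hq := chainDenom_ne_zero hk
  set q := chainDenom U V with hqdef
  -- `c` solves `k_V c + β_V G = z (k_U c + β_U)`: the last row of `V [c; G]` becomes `z` times the
  -- last row `S` of `U [c; I]`.
  set c : Fin p → RatFunc ℂ := fun j =>
    ((∑ l, C (V (Fin.last p) l.succ) * G l j) - X * C (U (Fin.last p) j.succ)) / q with hc
  set W₁ : Matrix (Fin (p + 1)) (Fin p) (RatFunc ℂ) :=
    Matrix.of fun i j => (Fin.cons (c j) fun i' => (1 : RatMat (Fin p) (Fin p)) i' j :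
      Fin (p + 1) → RatFunc ℂ) i with hW₁
  set W₂ : Matrix (Fin (p + 1)) (Fin p) (RatFunc ℂ) :=
    Matrix.of fun i j => (Fin.cons (c j) fun i' => G i' j : Fin (p + 1) → RatFunc ℂ) i with hW₂
  set A := (chainMat U V).toBlocks₁₂ * G + (chainMat U V).toBlocks₁₁ with hA
  set Y := (chainMat U V).toBlocks₂₂ * G + (chainMat U V).toBlocks₂₁ with hY
  set S : Fin p → RatFunc ℂ := fun j => C (kEntry U) * c j + C (U (Fin.last p) j.succ) with hS
  have hW : oneDiag G * W₁ = W₂ := by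
    ext i j
    rw [Matrix.mul_apply, Fin.sum_univ_succ]
    refine Fin.cases ?_ (fun i => ?_) i
    · simp [oneDiag, hW₁, hW₂]
    · simp [oneDiag, hW₁, hW₂, Matrix.one_apply]
  have hUU : constMat Uᴴ * constMat U = 1 := by
    have h := Matrix.mem_unitaryGroup_iff'.1 hU
    rw [Matrix.star_eq_conjTranspose] at h
    rw [constMat, constMat, ← Matrix.map_mul, h, Matrix.map_one _ (map_zero _) (map_one _)]
  have hR (i : Fin p) (j : Fin p) : (constMat U * W₁) i.castSucc j = A i j := by
    have e1 : (constMat U * W₁) i.castSucc j =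
        C (U i.castSucc 0) * c j + C (U i.castSucc j.succ) := by
      rw [Matrix.mul_apply, Fin.sum_univ_succ]
      simp [hW₁, constMat, Matrix.one_apply]
    rw [e1, hA, Matrix.add_apply, Matrix.mul_apply]
    simp only [Matrix.toBlocks₁₂, Matrix.toBlocks₁₁, Matrix.of_apply, chainMat_apply, chainConst,
      chainCol, chainRow, Matrix.fromBlocks_apply₁₁, Matrix.fromBlocks_apply₁₂, Sum.elim_inl,
      Sum.elim_inr, Matrix.zero_apply, map_zero, zero_add, hc, ← hqdef]
    rw [sub_div, Finset.sum_div, mul_sub, Finset.mul_sum]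
    have : ∀ l, C (U i.castSucc 0) * (C (V (Fin.last p) l.succ) / q) * G l j =
      C (U i.castSucc 0) * (C (V (Fin.last p) l.succ) * G l j / q) := fun l => by ring
    simp only [this]
    ring
  have hRl (j : Fin p) : (constMat U * W₁) (Fin.last p) j = S j := by
    rw [Matrix.mul_apply, Fin.sum_univ_succ]
    simp [hW₁, constMat, Matrix.one_apply, hS, kEntry]
  have hT (i : Fin p) (j : Fin p) : (constMat V * W₂) i.castSucc j = Y i j := by
    have e1 : (constMat V * W₂) i.castSucc j =
        C (V i.castSucc 0) * c j + ∑ l, C (V i.castSucc l.succ) * G l j := by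
      rw [Matrix.mul_apply, Fin.sum_univ_succ]
      simp [hW₂, constMat]
    rw [e1, hY, Matrix.add_apply, Matrix.mul_apply]
    simp only [Matrix.toBlocks₂₂, Matrix.toBlocks₂₁, Matrix.of_apply, chainMat_apply, chainConst,
      chainCol, chainRow, Matrix.fromBlocks_apply₂₂, Matrix.fromBlocks_apply₂₁, Sum.elim_inl,
      Sum.elim_inr, Matrix.zero_apply, map_zero, zero_add, hc, ← hqdef]
    rw [sub_div, Finset.sum_div, mul_sub, Finset.mul_sum]
    have : ∀ l, (C (V i.castSucc l.succ) +
        C (V i.castSucc 0) * (C (V (Fin.last p) l.succ) / q)) * G l j =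
      C (V i.castSucc l.succ) * G l j +
        C (V i.castSucc 0) * (C (V (Fin.last p) l.succ) * G l j / q) := fun l => by ring
    simp only [this, Finset.sum_add_distrib]
    ring
  have hTl (j : Fin p) : (constMat V * W₂) (Fin.last p) j = X * S j := by
    have e1 : (constMat V * W₂) (Fin.last p) j =
        C (kEntry V) * c j + ∑ l, C (V (Fin.last p) l.succ) * G l j := by
      rw [Matrix.mul_apply, Fin.sum_univ_succ]
      simp [hW₂, constMat, kEntry]
    have e2 : q * c j =
        (∑ l, C (V (Fin.last p) l.succ) * G l j) - X * C (U (Fin.last p) j.succ) := by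
      simp only [hc]
      field_simp
    rw [e1, hS]
    rw [hqdef, chainDenom] at e2
    linear_combination -e2
  have hM : matF U V G * (constMat U * W₁) = constMat V * W₂ := by
    rw [matF, Matrix.mul_assoc, ← Matrix.mul_assoc (constMat Uᴴ), hUU, Matrix.one_mul,
      Matrix.mul_assoc, hW]
  have hMi (i : Fin p) (j : Fin p) :
      (∑ l : Fin p, matF U V G i.castSucc l.castSucc * A l j)
        + matF U V G i.castSucc (Fin.last p) * S j = Y i j := by
    rw [← hT, ← hM, Matrix.mul_apply, Fin.sum_univ_castSucc, hRl]
    simp only [hR]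
  have hMl (j : Fin p) :
      (∑ l : Fin p, matF U V G (Fin.last p) l.castSucc * A l j)
        + matF U V G (Fin.last p) (Fin.last p) * S j = X * S j := by
    rw [← hTl, ← hM, Matrix.mul_apply, Fin.sum_univ_castSucc, hRl]
    simp only [hR]
  -- If `A d = 0`, the last row of `F [A; S] = [Y; z S]` gives `(z - F₄) S d = 0`, so `S d = 0`.
  -- Then `U W₁ d = 0`, and `d = 0` because `W₁` contains an identity block.
  have hunit : IsUnit A := by
    rw [← Matrix.mulVec_injective_iff_isUnit]
    refine (injective_iff_map_eq_zero A.mulVecLin).2 fun d hd => ?_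
    replace hd : A *ᵥ d = 0 := hd
    have hSd : ∑ j, S j * d j = 0 := by
      have h1 : (X - matF U V G (Fin.last p) (Fin.last p)) * ∑ j, S j * d j =
          ∑ l : Fin p, matF U V G (Fin.last p) l.castSucc * (A *ᵥ d) l := by
        simp only [Matrix.mulVec, dotProduct, Finset.mul_sum]
        rw [Finset.sum_comm]
        refine Finset.sum_congr rfl fun j _ => ?_
        rw [← mul_assoc, show (X - matF U V G (Fin.last p) (Fin.last p)) * S j =
          ∑ l : Fin p, matF U V G (Fin.last p) l.castSucc * A l j by
            linear_combination -(hMl j), Finset.sum_mul]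
        exact Finset.sum_congr rfl fun l _ => by ring
      rw [hd] at h1
      simpa [hF] using h1
    have hRd : (constMat U * W₁) *ᵥ d = 0 := by
      ext i
      refine Fin.lastCases ?_ (fun i => ?_) i
      · simpa [Matrix.mulVec, dotProduct, hRl] using hSd
      · simpa [Matrix.mulVec, dotProduct, hR] using congrFun hd i
    have hWd : W₁ *ᵥ d = 0 := by
      have := congrArg (constMat Uᴴ *ᵥ ·) hRd
      simpa [Matrix.mulVec_mulVec, ← Matrix.mul_assoc, hUU] using this
    ext i
    simpa [Matrix.mulVec, dotProduct, hW₁, Matrix.one_apply] using congrFun hWd i.succ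
  refine ⟨hunit, ?_⟩
  -- Substitute `S = F₃ A / (z - F₄)` into `F₁ A + F₂ S = Y`.
  have hFA : FUV U V G * A = Y := by
    ext i j
    rw [Matrix.mul_apply, ← hMi]
    have hSj : S j = (∑ l : Fin p, matF U V G (Fin.last p) l.castSucc * A l j) /
        (X - matF U V G (Fin.last p) (Fin.last p)) := by
      rw [eq_div_iff hF]
      linear_combination -(hMl j)
    rw [hSj, Finset.sum_div, Finset.mul_sum, ← Finset.sum_add_distrib]
    refine Finset.sum_congr rfl fun l _ => ?_
    simp only [FUV, Matrix.of_apply]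
    ring
  rw [LFT, ← hA, ← hY, ← hFA, Matrix.mul_nonsing_inv_cancel_right]
  exact (Matrix.isUnit_iff_isUnit_det _).1 hunit

variable (U V) in
-- The denominator satisfies `z⁻¹ k_U - k_V = -(z k_V - k_U) / z`; the extra factor `-z` passes from
-- one half of the row to the other.
theorem circ_chainMat : circ (chainMat U V) = chainMat V U := by
  have e : substInvHom (chainDenom U V) = - (chainDenom V U) / X := by
    have := RatFunc.X_ne_zero (K := ℂ)
    simp only [chainDenom, map_sub, map_mul, substInvHom_C, substInvHom_X]
    field_simp
    ring
  ext i j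
  rw [circ_apply, chainMat_apply, chainMat_apply, map_add, map_mul, substInvHom_C, substInvHom_C]
  have hX := RatFunc.X_ne_zero (K := ℂ)
  congr 1
  · rcases i with i | i <;> rcases j with j | j <;> simp [chainConst]
  · congr 1
    · rcases i with i | i <;> simp [chainCol]
    · rcases j with j | j <;> simp [chainRow, e] <;> field_simp

end chainMat

/-! ### Constant matrices inside rational matrices -/

theorem constMat_mul {l m n : Type*} [Fintype m] (A : Matrix l m ℂ) (B : Matrix m n ℂ) :
    constMat (A * B) = constMat A * constMat B :=
  Matrix.map_mul

theorem constMat_one {n : Type*} [DecidableEq n] : constMat (1 : Matrix n n ℂ) = 1 :=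
  Matrix.map_one _ (map_zero _) (map_one _)

theorem constMat_apply {m n : Type*} (A : Matrix m n ℂ) (i : m) (j : n) :
    constMat A i j = C (A i j) := rfl

/-! ### Uniqueness of linear fractional representations -/

section uniqueness

variable {p : ℕ}

theorem isLossless_constMat_smul_one {c : ℂ} (hc : star c * c = 1) :
    IsLossless (constMat (c • (1 : Matrix (Fin p) (Fin p) ℂ))) := by
  apply isLossless_constMat
  rw [Matrix.conjTranspose_smul, Matrix.conjTranspose_one, smul_mul_smul_comm, hc, one_smul,
    Matrix.one_mul]

theorem constMat_smul_one (c : ℂ) :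
    constMat (c • (1 : Matrix (Fin p) (Fin p) ℂ)) = C c • 1 := by
  ext i j
  by_cases h : i = j <;> simp [constMat_apply, h]

/-- A matrix commuting with all constant unitary matrices is scalar. -/
theorem eq_smul_one_of_commute {M : RatMat (Fin p) (Fin p)} (hp : 0 < p)
    (h : ∀ A : Matrix (Fin p) (Fin p) ℂ, Aᴴ * A = 1 → M * constMat A = constMat A * M) :
    ∃ φ : RatFunc ℂ, M = φ • (1 : RatMat (Fin p) (Fin p)) := by
  have hoff (a b : Fin p) (hab : a ≠ b) : M a b = 0 := by
    -- A sign flip at `a` forces `M a b = -M a b`; the transposition used later equates diagonal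
    -- entries.
    set d : Fin p → ℂ := Function.update 1 a (-1) with hd
    have hdd : ∀ i, star (d i) * d i = 1 := fun i => by
      by_cases hi : i = a <;> simp [hd, hi]
    have h1 := h (Matrix.diagonal d) (by
      rw [Matrix.diagonal_conjTranspose, Matrix.diagonal_mul_diagonal, ← Matrix.diagonal_one]
      exact congrArg _ (funext hdd))
    have h2 := congrFun (congrFun h1 a) b
    have h3 : constMat (Matrix.diagonal d) = Matrix.diagonal fun i => C (d i) :=
      Matrix.diagonal_map (map_zero _)
    rw [h3, Matrix.mul_diagonal, Matrix.diagonal_mul] at h2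
    simp only [hd, Function.update_apply, hab.symm, if_false, if_true, Pi.one_apply, map_one,
      map_neg, mul_one, neg_mul, one_mul] at h2
    exact self_eq_neg.1 h2
  have hdiag (a b : Fin p) : M a a = M b b := by
    set σ : Equiv.Perm (Fin p) := Equiv.swap a b with hσ
    have h1 := h (σ.permMatrix ℂ) (by
      rw [Matrix.conjTranspose_permMatrix, ← Matrix.permMatrix_mul, mul_inv_cancel,
        Matrix.permMatrix_one])
    have h2 := congrFun (congrFun h1 a) b
    have h3 : constMat (σ.permMatrix ℂ) = σ.permMatrix (RatFunc ℂ) := by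
      ext i j
      simp [constMat_apply, Equiv.Perm.permMatrix, PEquiv.toMatrix_apply, apply_ite]
    rw [h3, Equiv.Perm.permMatrix, PEquiv.toMatrix_toPEquiv_mul,
      PEquiv.mul_toMatrix_toPEquiv] at h2
    simpa [hσ] using h2
  refine ⟨M ⟨0, hp⟩ ⟨0, hp⟩, ?_⟩
  ext i j
  by_cases hij : i = j
  · subst hij; simpa using hdiag _ _
  · simp [hij, hoff]

/-- The matrix `Φ = Ψ⁻¹ Θ` fixes every lossless `G`. Scalar tests make `Φ` block diagonal with equal
blocks, and that block commutes with all constant unitary matrices, hence is scalar. -/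
theorem eq_smul_of_representedBy {F : RatMat (Fin p) (Fin p) → RatMat (Fin p) (Fin p)}
    {Θ Ψ : RatMat (Fin p ⊕ Fin p) (Fin p ⊕ Fin p)} (hp : 0 < p) (hΘ : RepresentedBy F Θ)
    (hΨ : RepresentedBy F Ψ) (hu : IsUnit Ψ) : ∃ φ : RatFunc ℂ, φ ≠ 0 ∧ Θ = φ • Ψ := by
  obtain ⟨Ξ, hΞ, hΞ'⟩ := isUnit_iff_exists.1 hu
  set Φ := Ξ * Θ with hΦ
  have hΘΦ : Θ = Ψ * Φ := by rw [hΦ, ← Matrix.mul_assoc, hΞ, Matrix.one_mul]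
  have key (G : RatMat (Fin p) (Fin p)) (hG : IsLossless G) :
      IsUnit (Φ.toBlocks₁₂ * G + Φ.toBlocks₁₁) ∧
        Φ.toBlocks₂₂ * G + Φ.toBlocks₂₁ = G * (Φ.toBlocks₁₂ * G + Φ.toBlocks₁₁) := by
    obtain ⟨hA, hFA⟩ := hΘ G hG
    obtain ⟨hB, hFB⟩ := hΨ G hG
    rw [InLFTDomain] at hA hB
    have hA' := (Matrix.isUnit_iff_isUnit_det _).1 hA
    have hB' := (Matrix.isUnit_iff_isUnit_det _).1 hB
    set A := Θ.toBlocks₁₂ * G + Θ.toBlocks₁₁ with hAd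
    set B := Ψ.toBlocks₁₂ * G + Ψ.toBlocks₁₁ with hBd
    set Q := B⁻¹ * A with hQ
    have hAQ : A = B * Q := by
      rw [hQ, Matrix.mul_nonsing_inv_cancel_left _ _ hB']
    have hYQ : Θ.toBlocks₂₂ * G + Θ.toBlocks₂₁ = (Ψ.toBlocks₂₂ * G + Ψ.toBlocks₂₁) * Q := by
      rw [LFT, ← hAd] at hFA
      rw [LFT, ← hBd] at hFB
      rw [hQ, ← Matrix.mul_assoc, ← hFB, hFA, Matrix.nonsing_inv_mul_cancel_right _ _ hA']
    -- The graph column `[1; G]` is padded with zero columns to stay within square block matrices.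
    have hcol (T : RatMat (Fin p ⊕ Fin p) (Fin p ⊕ Fin p)) : T * Matrix.fromBlocks 1 0 G 0 =
        Matrix.fromBlocks (T.toBlocks₁₂ * G + T.toBlocks₁₁) 0
          (T.toBlocks₂₂ * G + T.toBlocks₂₁) 0 := by
      conv_lhs => rw [← Matrix.fromBlocks_toBlocks T]
      simp [Matrix.fromBlocks_multiply, add_comm]
    have h1 : Θ * Matrix.fromBlocks 1 0 G 0 =
        Ψ * (Matrix.fromBlocks 1 0 G 0 * Matrix.fromBlocks Q 0 0 0) := by
      rw [← Matrix.mul_assoc, hcol, hcol, Matrix.fromBlocks_multiply, ← hAd, ← hBd, hYQ, hAQ]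
      simp
    have h2 : Φ * Matrix.fromBlocks 1 0 G 0 = Matrix.fromBlocks Q 0 (G * Q) 0 := by
      rw [hΦ, Matrix.mul_assoc, h1, ← Matrix.mul_assoc, hΞ', Matrix.one_mul,
        Matrix.fromBlocks_multiply]
      simp
    rw [hcol, Matrix.fromBlocks_inj] at h2
    rw [h2.1, h2.2.2.1]
    exact ⟨((Matrix.isUnit_nonsing_inv_iff).2 hB).mul hA, rfl⟩
  have hscal (c : ℂ) (hc : star c * c = 1) := (key _ (isLossless_constMat_smul_one hc)).2
  simp only [constMat_smul_one] at hscal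
  -- For `G = c I` the relation reads `c Φ₂₂ + Φ₂₁ = c² Φ₁₂ + c Φ₁₁`. The values `c = ±1` give `Φ₂₁
  -- = Φ₁₂` and `Φ₂₂ = Φ₁₁`; `c = i`, where `c² = -1`, kills `Φ₁₂`.
  have h1 := hscal 1 (by simp)
  have h2 := hscal (-1) (by simp)
  have h3 := hscal Complex.I (by simp)
  simp only [map_one, map_neg, one_smul, neg_smul, Matrix.mul_one, Matrix.one_mul, Matrix.mul_neg,
    Matrix.neg_mul, Matrix.mul_smul, Matrix.smul_mul, smul_add, smul_smul] at h1 h2 h3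
  have hI : (C Complex.I : RatFunc ℂ) * C Complex.I = -1 := by
    rw [← map_mul, Complex.I_mul_I, map_neg, map_one]
  have e12 (i j : Fin p) : Φ.toBlocks₂₁ i j = Φ.toBlocks₁₂ i j ∧
      Φ.toBlocks₂₂ i j = Φ.toBlocks₁₁ i j ∧ Φ.toBlocks₁₂ i j = 0 := by
    have a1 := congrFun (congrFun h1 i) j
    have a2 := congrFun (congrFun h2 i) j
    have a3 := congrFun (congrFun h3 i) j
    simp only [Matrix.add_apply, Matrix.neg_apply, Matrix.smul_apply, smul_eq_mul, hI] at a1 a2 a3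
    have b1 : Φ.toBlocks₂₁ i j = Φ.toBlocks₁₂ i j := by linear_combination (a1 + a2) / 2
    have b2 : Φ.toBlocks₂₂ i j = Φ.toBlocks₁₁ i j := by linear_combination (a1 - a2) / 2
    exact ⟨b1, b2, by rw [b1, b2] at a3; linear_combination a3 / 2⟩
  have z12 : Φ.toBlocks₁₂ = 0 := by ext i j; exact (e12 i j).2.2
  have z21 : Φ.toBlocks₂₁ = 0 := by ext i j; rw [(e12 i j).1]; exact (e12 i j).2.2
  have z22 : Φ.toBlocks₂₂ = Φ.toBlocks₁₁ := by ext i j; exact (e12 i j).2.1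
  rw [z12, z21, z22] at key
  simp only [Matrix.zero_mul, zero_add, add_zero] at key
  obtain ⟨φ, hφ⟩ := eq_smul_one_of_commute hp fun A hA => (key _ (isLossless_constMat hA)).2
  have hΦφ : Φ = φ • 1 := by
    rw [← Matrix.fromBlocks_toBlocks Φ, z12, z21, z22, hφ, ← Matrix.fromBlocks_one,
      Matrix.fromBlocks_smul, smul_zero]
  refine ⟨φ, ?_, by rw [hΘΦ, hΦφ, Matrix.mul_smul, Matrix.mul_one]⟩
  rintro rfl
  have hu1 := (key _ (isLossless_constMat (A := 1) (by simp))).1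
  rw [hφ, zero_smul] at hu1
  have : Nonempty (Fin p) := ⟨⟨0, hp⟩⟩
  exact not_isUnit_zero hu1

theorem representedBy_smul {F : RatMat (Fin p) (Fin p) → RatMat (Fin p) (Fin p)}
    {Θ : RatMat (Fin p ⊕ Fin p) (Fin p ⊕ Fin p)} {φ : RatFunc ℂ} (hφ : φ ≠ 0)
    (hΘ : RepresentedBy F Θ) : RepresentedBy F (φ • Θ) := by
  intro G hG
  obtain ⟨hA, hF⟩ := hΘ G hG
  rw [InLFTDomain] at hA
  have e (T T' : RatMat (Fin p) (Fin p)) : φ • T * G + φ • T' = φ • (T * G + T') := by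
    rw [Matrix.smul_mul, smul_add]
  have e11 : (φ • Θ).toBlocks₁₁ = φ • Θ.toBlocks₁₁ := rfl
  have e12 : (φ • Θ).toBlocks₁₂ = φ • Θ.toBlocks₁₂ := rfl
  have e21 : (φ • Θ).toBlocks₂₁ = φ • Θ.toBlocks₂₁ := rfl
  have e22 : (φ • Θ).toBlocks₂₂ = φ • Θ.toBlocks₂₂ := rfl
  have hA' := (Matrix.isUnit_iff_isUnit_det _).1 hA
  refine ⟨?_, ?_⟩
  · rw [InLFTDomain, e11, e12, e]
    rw [Matrix.isUnit_iff_isUnit_det, Matrix.det_smul]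
    exact ((IsUnit.mk0 φ hφ).pow _).mul hA'
  · rw [hF, LFT, LFT, e11, e12, e21, e22, e, e]
    have : (φ • (Θ.toBlocks₁₂ * G + Θ.toBlocks₁₁))⁻¹ =
        φ⁻¹ • (Θ.toBlocks₁₂ * G + Θ.toBlocks₁₁)⁻¹ := by
      apply Matrix.inv_eq_right_inv
      rw [smul_mul_smul_comm, mul_inv_cancel₀ hφ, one_smul, Matrix.mul_nonsing_inv _ hA']
    rw [this, smul_mul_smul_comm, mul_inv_cancel₀ hφ, one_smul]

/-- If `k_U = k_V = 0`, then `FUV U V` satisfies a linear constraint that no linear fractional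
transformation satisfies. -/
theorem not_representedBy_of_kEntry_eq_zero {U V : Matrix (Fin (p + 1)) (Fin (p + 1)) ℂ}
    (hV : V ∈ Matrix.unitaryGroup (Fin (p + 1)) ℂ) (hkU : kEntry U = 0) (hkV : kEntry V = 0)
    {Ψ : RatMat (Fin p ⊕ Fin p) (Fin p ⊕ Fin p)} (hu : IsUnit Ψ) :
    ¬RepresentedBy (FUV U V) Ψ := by
  intro hΨ
  set a : Fin p → RatFunc ℂ := fun j => C (star (U j.castSucc 0)) with ha
  set b : Fin p → RatFunc ℂ := fun j => C (star (V j.castSucc 0)) with hb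
  -- The first row of `V* F = diag(1, G) U*`, where `k_V = 0` removes the last term of the sum.
  have hrow (G : RatMat (Fin p) (Fin p)) (j : Fin (p + 1)) :
      ∑ i : Fin p, b i * matF U V G i.castSucc j = C (star (U j 0)) := by
    have hVV : constMat Vᴴ * constMat V = 1 := by
      rw [← constMat_mul, ← constMat_one]
      exact congrArg _ (Matrix.mem_unitaryGroup_iff'.1 hV)
    have h1 : constMat Vᴴ * matF U V G = oneDiag G * constMat Uᴴ := by
      rw [matF, Matrix.mul_assoc, ← Matrix.mul_assoc (constMat Vᴴ), hVV, Matrix.one_mul]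
    have h2 := congrFun (congrFun h1 0) j
    rw [Matrix.mul_apply, Matrix.mul_apply, Fin.sum_univ_castSucc,
      Fin.sum_univ_succ (f := fun i => oneDiag G 0 i * constMat Uᴴ i j)] at h2
    have h3 : star (V (Fin.last p) 0) = 0 := by
      rw [kEntry] at hkV
      rw [hkV, star_zero]
    simp only [constMat_apply, Matrix.conjTranspose_apply, h3, map_zero, zero_mul, add_zero] at h2
    rw [hb, h2]
    simp [oneDiag]
  -- By `k_U = 0`, `hrow` gives `α_V* F₂ = 0`, so the feedback term disappears.
  have hF (G : RatMat (Fin p) (Fin p)) : b ᵥ* FUV U V G = a := by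
    ext j
    simp only [Matrix.vecMul, dotProduct, FUV, Matrix.of_apply, mul_add, Finset.sum_add_distrib]
    rw [hrow]
    have h4 : ∑ i : Fin p, b i * (matF U V G i.castSucc (Fin.last p) *
        matF U V G (Fin.last p) j.castSucc / (X - matF U V G (Fin.last p) (Fin.last p))) = 0 := by
      have h5 := hrow G (Fin.last p)
      have h6 : star (U (Fin.last p) 0) = 0 := by
        rw [kEntry] at hkU
        rw [hkU, star_zero]
      rw [h6, map_zero] at h5
      calc _ = (∑ i : Fin p, b i * matF U V G i.castSucc (Fin.last p)) *
          (matF U V G (Fin.last p) j.castSucc / (X - matF U V G (Fin.last p) (Fin.last p))) := by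
            rw [Finset.sum_mul]
            exact Finset.sum_congr rfl fun i _ => by ring
        _ = 0 := by rw [h5, zero_mul]
    rw [h4, add_zero]
  have key (G : RatMat (Fin p) (Fin p)) (hG : IsLossless G) :
      b ᵥ* (Ψ.toBlocks₂₂ * G + Ψ.toBlocks₂₁) = a ᵥ* (Ψ.toBlocks₁₂ * G + Ψ.toBlocks₁₁) := by
    obtain ⟨hA, hFA⟩ := hΨ G hG
    have hA' := (Matrix.isUnit_iff_isUnit_det _).1 hA
    rw [← hF G, hFA, LFT, Matrix.vecMul_vecMul, Matrix.nonsing_inv_mul_cancel_right _ _ hA']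
  have hscal (c : ℂ) (hc : star c * c = 1) := key _ (isLossless_constMat_smul_one hc)
  simp only [constMat_smul_one, Matrix.mul_smul, Matrix.mul_one, Matrix.vecMul_add,
    Matrix.vecMul_smul] at hscal
  have h1 := hscal 1 (by simp)
  have h2 := hscal (-1) (by simp)
  simp only [map_one, map_neg, one_smul, neg_smul] at h1 h2
  have e1 : b ᵥ* Ψ.toBlocks₂₁ = a ᵥ* Ψ.toBlocks₁₁ := by
    ext j
    have a1 := congrFun h1 j
    have a2 := congrFun h2 j
    simp only [Pi.add_apply, Pi.neg_apply] at a1 a2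
    linear_combination (a1 + a2) / 2
  have e2 : b ᵥ* Ψ.toBlocks₂₂ = a ᵥ* Ψ.toBlocks₁₂ := by
    ext j
    have a1 := congrFun h1 j
    have a2 := congrFun h2 j
    simp only [Pi.add_apply, Pi.neg_apply] at a1 a2
    linear_combination (a1 - a2) / 2
  -- The constraint is a left kernel vector of the invertible `Ψ`, hence zero; with `k_V = 0` the
  -- first column of `V` would vanish.
  have h0 : Sum.elim (-a) b ᵥ* Ψ = 0 := by
    rw [← Matrix.fromBlocks_toBlocks Ψ, Matrix.vecMul_fromBlocks]
    ext j
    rcases j with j | j <;>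
      simp only [Sum.elim_comp_inl, Sum.elim_comp_inr, e1, e2, Matrix.neg_vecMul, Sum.elim_inl,
        Sum.elim_inr, Pi.zero_apply, neg_add_cancel]
  have hz : Sum.elim (-a) b = 0 := by
    apply Matrix.vecMul_injective_of_isUnit hu
    simpa using h0
  have hcol := congrFun (congrFun (Matrix.mem_unitaryGroup_iff'.1 hV) 0) 0
  rw [Matrix.mul_apply, Fin.sum_univ_castSucc] at hcol
  have hVz (i : Fin p) : V i.castSucc 0 = 0 := by
    have := congrFun hz (Sum.inr i)
    simpa [hb] using this
  rw [kEntry] at hkV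
  simp [hVz, hkV] at hcol

end uniqueness

/-! ### The elementary factors `Theta` -/

section Theta

variable {p : ℕ}

theorem blaschke_denom_ne_zero (w : ℂ) : (1 - C (star w) * X : RatFunc ℂ) ≠ 0 := by
  intro h
  have h1 : X * C (star w) - C 1 = (0 : RatFunc ℂ) := by
    rw [map_one]
    linear_combination -h
  exact one_ne_zero (eq_zero_of_C_mul_X_add_C h1).2

theorem X_sub_C_ne_zero (w : ℂ) : (X - C w : RatFunc ℂ) ≠ 0 := by
  intro h
  have h1 : X * C 1 - C w = (0 : RatFunc ℂ) := by
    rw [map_one]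
    linear_combination h
  exact one_ne_zero (eq_zero_of_C_mul_X_add_C h1).1

theorem blaschke_ne_zero (w : ℂ) : blaschke w ≠ 0 :=
  div_ne_zero (X_sub_C_ne_zero w) (blaschke_denom_ne_zero w)

theorem blaschkeAt_ne_zero {w ξ : ℂ} (hw : ‖w‖ < 1) (hξ : ‖ξ‖ = 1) : blaschkeAt w ξ ≠ 0 := by
  refine div_ne_zero ?_ ?_
  · intro h
    rw [sub_eq_zero] at h
    rw [h] at hξ
    linarith
  · intro h
    have : ‖star w * ξ‖ = 1 := by
      rw [← sub_eq_zero.1 h, norm_one]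
    rw [norm_mul, hξ, norm_star] at this
    linarith

/-- The row `[u; v]* J = [u*, -v*]`. -/
noncomputable def stackRow (u v : EuclideanSpace ℂ (Fin p)) : Fin p ⊕ Fin p → ℂ :=
  Sum.elim (fun i => star (u i)) (fun i => -star (v i))

theorem star_stack_vecMul_sigJ (u v : EuclideanSpace ℂ (Fin p)) :
    star (stack u v) ᵥ* sigJ p = stackRow u v := by
  rw [sigJ, Matrix.vecMul_fromBlocks]
  ext i
  rcases i with i | i <;> simp [stackRow, stack, Matrix.vecMul_neg]

theorem stackRow_dotProduct_stack (u v : EuclideanSpace ℂ (Fin p)) :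
    stackRow u v ⬝ᵥ stack u v = (‖u‖ : ℂ) ^ 2 - (‖v‖ : ℂ) ^ 2 := by
  have e (y : EuclideanSpace ℂ (Fin p)) : ∑ i, star (y i) * y i = (‖y‖ : ℂ) ^ 2 := by
    rw [← Complex.ofReal_pow, EuclideanSpace.norm_sq_eq]
    push_cast
    exact Finset.sum_congr rfl fun i _ => by rw [RCLike.star_def, Complex.conj_mul']
  simp only [dotProduct, stackRow, stack, Fintype.sum_sum_type, Sum.elim_inl, Sum.elim_inr,
    neg_mul, Finset.sum_neg_distrib, e]
  ring

/-- The rank one projection `[u; v] [u; v]* J / (1 - ‖v‖²)`. -/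
noncomputable def stackProj (u v : EuclideanSpace ℂ (Fin p)) :
    Matrix (Fin p ⊕ Fin p) (Fin p ⊕ Fin p) ℂ :=
  (1 - (‖v‖ : ℂ) ^ 2)⁻¹ • Matrix.vecMulVec (stack u v) (stackRow u v)

theorem Theta_eq (u v : EuclideanSpace ℂ (Fin p)) (w ξ : ℂ)
    (H : Matrix (Fin p ⊕ Fin p) (Fin p ⊕ Fin p) ℂ) :
    Theta u v w ξ H =
      (1 + (blaschke w / C (blaschkeAt w ξ) - 1) • constMat (stackProj u v)) * constMat H := by
  rw [Theta, stackProj, Matrix.vecMulVec_mul, star_stack_vecMul_sigJ]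

theorem Theta_apply (u v : EuclideanSpace ℂ (Fin p)) (w ξ : ℂ)
    (H : Matrix (Fin p ⊕ Fin p) (Fin p ⊕ Fin p) ℂ) (i j : Fin p ⊕ Fin p) :
    Theta u v w ξ H i j = C (H i j) + (blaschke w / C (blaschkeAt w ξ) - 1) *
      C ((stackProj u v * H) i j) := by
  rw [Theta_eq, Matrix.add_mul, Matrix.one_mul, Matrix.smul_mul, ← constMat_mul]
  rfl

theorem one_sub_norm_sq_ne_zero {v : EuclideanSpace ℂ (Fin p)} (hv : ‖v‖ < 1) :
    (1 - (‖v‖ : ℂ) ^ 2) ≠ 0 := by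
  have : (1 - ‖v‖ ^ 2 : ℝ) ≠ 0 := by nlinarith [norm_nonneg v]
  exact_mod_cast this

theorem stackProj_mul_stackProj {u v : EuclideanSpace ℂ (Fin p)} (hu : ‖u‖ = 1) (hv : ‖v‖ < 1) :
    stackProj u v * stackProj u v = stackProj u v := by
  rw [stackProj, smul_mul_smul_comm, Matrix.vecMulVec_mul_vecMulVec, stackRow_dotProduct_stack, hu]
  have := one_sub_norm_sq_ne_zero hv
  ext i j
  simp only [Matrix.smul_apply, Matrix.vecMulVec_apply, Pi.smul_apply, smul_eq_mul,
    Complex.ofReal_one, one_pow]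
  field_simp

theorem sigJ_mul_sigJ : sigJ p * sigJ p = 1 := by
  simp [sigJ, Matrix.fromBlocks_multiply, ← Matrix.fromBlocks_one]

theorem IsJUnitary.isUnit {H : Matrix (Fin p ⊕ Fin p) (Fin p ⊕ Fin p) ℂ} (h : IsJUnitary H) :
    IsUnit H := by
  have h1 : (sigJ p * Hᴴ * sigJ p) * H = 1 := by
    rw [Matrix.mul_assoc, Matrix.mul_assoc, ← Matrix.mul_assoc Hᴴ, h, sigJ_mul_sigJ]
  exact (Matrix.isUnit_iff_isUnit_det _).2 (Matrix.isUnit_det_of_left_inverse h1)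

theorem isUnit_constMat {n : Type*} [Fintype n] [DecidableEq n] {A : Matrix n n ℂ}
    (h : IsUnit A) : IsUnit (constMat A) := by
  obtain ⟨B, h1, h2⟩ := isUnit_iff_exists.1 h
  exact isUnit_iff_exists.2 ⟨constMat B, by rw [← constMat_mul, h1, constMat_one],
    by rw [← constMat_mul, h2, constMat_one]⟩

/-- The map `c ↦ 1 + (c - 1) P` is multiplicative: it acts as `c` on the range of `P` and as `1` on
its kernel. -/
theorem isUnit_one_add_smul_of_idempotent {n : Type*} [Fintype n] [DecidableEq n]
    {P : RatMat n n} (hP : P * P = P) {b : RatFunc ℂ} (hb : b ≠ 0) :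
    IsUnit (1 + (b - 1) • P) := by
  have h (c d : RatFunc ℂ) (hcd : c * d = 1) : (1 + (c - 1) • P) * (1 + (d - 1) • P) = 1 := by
    rw [Matrix.mul_add, Matrix.add_mul, Matrix.add_mul, smul_mul_smul_comm, hP, Matrix.one_mul,
      Matrix.one_mul, Matrix.mul_one, add_assoc, ← add_smul, ← add_smul]
    have : c - 1 + (d - 1 + (c - 1) * (d - 1)) = 0 := by linear_combination hcd
    rw [this, zero_smul, add_zero]
  exact isUnit_iff_exists.2 ⟨1 + (b⁻¹ - 1) • P, h _ _ (mul_inv_cancel₀ hb),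
    h _ _ (inv_mul_cancel₀ hb)⟩

theorem IsThetaParam.isUnit_Theta {u v : EuclideanSpace ℂ (Fin p)} {w ξ : ℂ}
    {H : Matrix (Fin p ⊕ Fin p) (Fin p ⊕ Fin p) ℂ} (h : IsThetaParam u v w ξ H) :
    IsUnit (Theta u v w ξ H) := by
  rw [Theta_eq]
  refine IsUnit.mul (isUnit_one_add_smul_of_idempotent ?_ ?_) (isUnit_constMat h.junitary.isUnit)
  · rw [← constMat_mul, stackProj_mul_stackProj h.norm_u h.norm_v]
  · exact div_ne_zero (blaschke_ne_zero w)
      ((map_ne_zero _).2 (blaschkeAt_ne_zero h.norm_w h.norm_xi))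

end Theta

/-! ### The chain matrix is an elementary factor if `|k_U| < |k_V|` -/

section existence

variable {p : ℕ} {U V : Matrix (Fin (p + 1)) (Fin (p + 1)) ℂ}

/-- Orthonormality of the columns with the last row split off, the form in which unitarity enters
the computations below. -/
theorem sum_star_mul_col (hU : U ∈ Matrix.unitaryGroup (Fin (p + 1)) ℂ) (j l : Fin (p + 1)) :
    ∑ i : Fin p, star (U i.castSucc j) * U i.castSucc l =
      (1 : Matrix (Fin (p + 1)) (Fin (p + 1)) ℂ) j l -
        star (U (Fin.last p) j) * U (Fin.last p) l := by
  have h := congrFun (congrFun (Matrix.mem_unitaryGroup_iff'.1 hU) j) l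
  rw [Matrix.mul_apply, Fin.sum_univ_castSucc] at h
  simp only [Matrix.star_apply] at h
  linear_combination h

variable (U V) in
/-- The value at `1` of the row `[-z β_U*, β_V*] / (z k_U - k_V)`. -/
noncomputable def chainRowOne : Fin p ⊕ Fin p → ℂ :=
  Sum.elim (fun j => -U (Fin.last p) j.succ / (kEntry U - kEntry V))
    (fun j => V (Fin.last p) j.succ / (kEntry U - kEntry V))

variable (U V) in
/-- The value at `1` of the chain matrix. -/
noncomputable def chainMatOne : Matrix (Fin p ⊕ Fin p) (Fin p ⊕ Fin p) ℂ :=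
  chainConst U V + Matrix.vecMulVec (chainCol U V) (chainRowOne U V)

theorem chainMatOne_apply (i j : Fin p ⊕ Fin p) : chainMatOne U V i j =
    chainConst U V i j + chainCol U V i * chainRowOne U V j := rfl

/-- On `[x; y]` the matrix gives the upper parts of `U [c; x]` and `V [c; y]`, with `c` chosen so
that the two last entries agree. Both maps are isometric, so subtracting squared norms cancels `c`
and the common entry, leaving `‖x‖² - ‖y‖²`. The proof checks this entrywise. -/
theorem isJUnitary_chainMatOne (hU : U ∈ Matrix.unitaryGroup (Fin (p + 1)) ℂ)
    (hV : V ∈ Matrix.unitaryGroup (Fin (p + 1)) ℂ) (hk : kEntry U ≠ kEntry V) :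
    IsJUnitary (chainMatOne U V) := by
  have hd : kEntry U - kEntry V ≠ 0 := sub_ne_zero.2 hk
  have hd' : star (kEntry U) - star (kEntry V) ≠ 0 := by
    rw [← star_sub]; exact star_ne_zero.2 hd
  have hJ (i j : Fin p ⊕ Fin p) : ((chainMatOne U V)ᴴ * sigJ p * chainMatOne U V) i j =
      ∑ l : Fin p, star (chainMatOne U V (Sum.inl l) i) * chainMatOne U V (Sum.inl l) j
        - ∑ l : Fin p, star (chainMatOne U V (Sum.inr l) i) * chainMatOne U V (Sum.inr l) j := by
    rw [Matrix.mul_assoc, Matrix.mul_apply, Fintype.sum_sum_type, sigJ, sub_eq_add_neg,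
      ← Finset.sum_neg_distrib]
    have e (M : Matrix (Fin p ⊕ Fin p) (Fin p ⊕ Fin p) ℂ) :
        Matrix.fromBlocks (1 : Matrix (Fin p) (Fin p) ℂ) 0 0 (-1) * M =
        Matrix.fromBlocks M.toBlocks₁₁ M.toBlocks₁₂ (-M.toBlocks₂₁) (-M.toBlocks₂₂) := by
      conv_lhs => rw [← Matrix.fromBlocks_toBlocks M]
      simp [Matrix.fromBlocks_multiply]
    rw [e]
    rcases j with j | j <;>
      simp [Matrix.toBlocks₁₁, Matrix.toBlocks₁₂, Matrix.toBlocks₂₁, Matrix.toBlocks₂₂]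
  -- The coefficients `e`, `e'` are later `1` or `0`, according to whether the block of `diag(M_U,
  -- M_V)` is present or zero.
  have hexp (W : Matrix (Fin (p + 1)) (Fin (p + 1)) ℂ)
      (hW : W ∈ Matrix.unitaryGroup (Fin (p + 1)) ℂ) (e e' : ℂ) (j j' : Fin (p + 1)) (r r' : ℂ) :
      ∑ l : Fin p, star (e * W l.castSucc j + W l.castSucc 0 * r) *
          (e' * W l.castSucc j' + W l.castSucc 0 * r') =
        star e * e' * ((1 : Matrix (Fin (p + 1)) (Fin (p + 1)) ℂ) j j' -
            star (W (Fin.last p) j) * W (Fin.last p) j')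
        + star e * r' * ((1 : Matrix (Fin (p + 1)) (Fin (p + 1)) ℂ) j 0 -
            star (W (Fin.last p) j) * kEntry W)
        + star r * e' * ((1 : Matrix (Fin (p + 1)) (Fin (p + 1)) ℂ) 0 j' -
            star (kEntry W) * W (Fin.last p) j')
        + star r * r' * (1 - star (kEntry W) * kEntry W) := by
    have h1 := sum_star_mul_col hW j j'
    have h2 := sum_star_mul_col hW j 0
    have h3 := sum_star_mul_col hW 0 j'
    have h4 := sum_star_mul_col hW 0 0
    rw [Matrix.one_apply_eq] at h4
    rw [kEntry, ← h1, ← h2, ← h3, ← h4, Finset.mul_sum, Finset.mul_sum, Finset.mul_sum,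
      Finset.mul_sum, ← Finset.sum_add_distrib, ← Finset.sum_add_distrib, ← Finset.sum_add_distrib]
    refine Finset.sum_congr rfl fun l _ => ?_
    simp only [star_add, star_mul']
    ring
  ext i j
  rw [hJ]
  rcases i with i | i <;> rcases j with j | j
  · have e1 := hexp U hU 1 1 i.succ j.succ (chainRowOne U V (Sum.inl i))
      (chainRowOne U V (Sum.inl j))
    have e2 := hexp V hV 0 0 i.succ j.succ (chainRowOne U V (Sum.inl i))
      (chainRowOne U V (Sum.inl j))
    simp only [one_mul, zero_mul, zero_add] at e1 e2
    simp only [chainMatOne_apply, chainConst, Matrix.fromBlocks_apply₁₁,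
      Matrix.fromBlocks_apply₂₁, chainCol, Sum.elim_inl, Sum.elim_inr, Matrix.of_apply,
      Matrix.zero_apply, zero_add, e1, e2]
    simp only [chainRowOne, Sum.elim_inl, sigJ, Matrix.fromBlocks_apply₁₁, Matrix.one_apply,
      Fin.succ_inj, Fin.succ_ne_zero, (Fin.succ_ne_zero _).symm, if_false, star_one, star_zero,
      star_div₀, star_neg, star_sub]
    split_ifs <;> field_simp <;> ring
  · have e1 := hexp U hU 1 0 i.succ j.succ (chainRowOne U V (Sum.inl i))
      (chainRowOne U V (Sum.inr j))
    have e2 := hexp V hV 0 1 i.succ j.succ (chainRowOne U V (Sum.inl i))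
      (chainRowOne U V (Sum.inr j))
    simp only [one_mul, zero_mul, zero_add] at e1 e2
    simp only [chainMatOne_apply, chainConst, Matrix.fromBlocks_apply₁₁,
      Matrix.fromBlocks_apply₂₁, Matrix.fromBlocks_apply₁₂,
      Matrix.fromBlocks_apply₂₂, chainCol, Sum.elim_inl, Sum.elim_inr, Matrix.of_apply,
      Matrix.zero_apply, zero_add, e1, e2]
    simp only [chainRowOne, Sum.elim_inl, Sum.elim_inr, sigJ, Matrix.fromBlocks_apply₁₂,
      Matrix.one_apply, Matrix.zero_apply,
      Fin.succ_inj, Fin.succ_ne_zero, (Fin.succ_ne_zero _).symm, if_false, star_one, star_zero,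
      star_div₀, star_neg, star_sub]
    field_simp
    ring
  · have e1 := hexp U hU 0 1 i.succ j.succ (chainRowOne U V (Sum.inr i))
      (chainRowOne U V (Sum.inl j))
    have e2 := hexp V hV 1 0 i.succ j.succ (chainRowOne U V (Sum.inr i))
      (chainRowOne U V (Sum.inl j))
    simp only [one_mul, zero_mul, zero_add] at e1 e2
    simp only [chainMatOne_apply, chainConst, Matrix.fromBlocks_apply₁₁,
      Matrix.fromBlocks_apply₂₁, Matrix.fromBlocks_apply₁₂,
      Matrix.fromBlocks_apply₂₂, chainCol, Sum.elim_inl, Sum.elim_inr, Matrix.of_apply,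
      Matrix.zero_apply, zero_add, e1, e2]
    simp only [chainRowOne, Sum.elim_inl, Sum.elim_inr, sigJ, Matrix.fromBlocks_apply₂₁,
      Matrix.one_apply, Matrix.zero_apply,
      Fin.succ_inj, Fin.succ_ne_zero, (Fin.succ_ne_zero _).symm, if_false, star_one, star_zero,
      star_div₀, star_sub]
    field_simp
    ring
  · have e1 := hexp U hU 0 0 i.succ j.succ (chainRowOne U V (Sum.inr i))
      (chainRowOne U V (Sum.inr j))
    have e2 := hexp V hV 1 1 i.succ j.succ (chainRowOne U V (Sum.inr i))
      (chainRowOne U V (Sum.inr j))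
    simp only [one_mul, zero_mul, zero_add] at e1 e2
    simp only [chainMatOne_apply, chainConst, Matrix.fromBlocks_apply₁₂,
      Matrix.fromBlocks_apply₂₂, chainCol, Sum.elim_inl, Sum.elim_inr, Matrix.of_apply,
      Matrix.zero_apply, zero_add, e1, e2]
    simp only [chainRowOne, Sum.elim_inr, sigJ, Matrix.fromBlocks_apply₂₂, Matrix.one_apply,
      Matrix.neg_apply,
      Fin.succ_inj, Fin.succ_ne_zero, (Fin.succ_ne_zero _).symm, if_false, star_one, star_zero,
      star_div₀, star_sub]
    split_ifs <;> field_simp <;> ring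

end existence

theorem one_sub_star_mul_self_ne_zero {w : ℂ} (hw : ‖w‖ < 1) : 1 - star w * w ≠ 0 := by
  rw [RCLike.star_def, Complex.conj_mul']
  have : (1 - ‖w‖ ^ 2 : ℝ) ≠ 0 := by nlinarith [norm_nonneg w]
  exact_mod_cast this

section existence

variable {p : ℕ} {U V : Matrix (Fin (p + 1)) (Fin (p + 1)) ℂ}

/-- For `w = star (a / b)` the pole `1 / w̄` is the zero of `z a - b`, and normalising at `1`
produces the factor `z - 1`. -/
theorem blaschke_div_blaschkeAt_one_sub_one {a b : ℂ} (hab : ‖a‖ < ‖b‖) :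
    blaschke (star (a / b)) / C (blaschkeAt (star (a / b)) 1) - 1 =
      (X - 1) * C ((star b * b - star a * a) / (star a - star b)) / (X * C a - C b) := by
  have hb : b ≠ 0 := by rintro rfl; simp at hab; linarith [norm_nonneg a]
  have hne : a - b ≠ 0 := by
    intro h; rw [sub_eq_zero.1 h] at hab; exact lt_irrefl _ hab
  have hne' : star a - star b ≠ 0 := by rw [← star_sub]; exact star_ne_zero.2 hne
  have hb' : star b ≠ 0 := star_ne_zero.2 hb
  have hq : (X * C a - C b : RatFunc ℂ) ≠ 0 := fun h => hb (eq_zero_of_C_mul_X_add_C h).2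
  have cb : (C b : RatFunc ℂ) ≠ 0 := (map_ne_zero _).2 hb
  have cb' : (C (star b) : RatFunc ℂ) ≠ 0 := (map_ne_zero _).2 hb'
  have cne : (C a - C b : RatFunc ℂ) ≠ 0 := by rw [← map_sub]; exact (map_ne_zero _).2 hne
  have cne' : (C (star a) - C (star b) : RatFunc ℂ) ≠ 0 := by
    rw [← map_sub]; exact (map_ne_zero _).2 hne'
  have e1 : blaschke (star (a / b)) =
      -(C b * (C (star b) * X - C (star a))) / (C (star b) * (X * C a - C b)) := by
    have h := blaschke_denom_ne_zero (star (a / b))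
    rw [blaschke, div_eq_div_iff h (mul_ne_zero cb' hq)]
    rw [star_star, star_div₀, map_div₀, map_div₀]
    field_simp
    ring
  have e2 : blaschkeAt (star (a / b)) 1 =
      b * (star a - star b) / (star b * (a - b)) := by
    have h : 1 - a / b ≠ 0 := by
      intro h
      apply hne
      field_simp at h
      linear_combination -h
    rw [blaschkeAt, star_star, mul_one, div_eq_div_iff h (mul_ne_zero hb' hne), star_div₀]
    field_simp
    ring
  rw [e1, e2]
  simp only [map_div₀, map_mul, map_sub]
  -- Keeps the denominator an atom for `field_simp`.
  obtain ⟨q, hqd⟩ : ∃ q : RatFunc ℂ, q = X * C a - C b := ⟨_, rfl⟩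
  rw [← hqd] at hq ⊢
  field_simp
  rw [hqd]
  ring

variable (U) in
/-- The column `α_U`. -/
noncomputable def alphaCol : EuclideanSpace ℂ (Fin p) := WithLp.toLp 2 fun i => U i.castSucc 0

theorem norm_sq_alphaCol (hU : U ∈ Matrix.unitaryGroup (Fin (p + 1)) ℂ) :
    ‖alphaCol U‖ ^ 2 = 1 - ‖kEntry U‖ ^ 2 := by
  have h := sum_star_mul_col hU 0 0
  simp only [RCLike.star_def, Complex.conj_mul', Matrix.one_apply_eq] at h
  rw [EuclideanSpace.norm_sq_eq]
  exact_mod_cast h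

/-- Computes the row of the rank one matrix `P H`, where `P` is the projection on `[α_U; α_V]` and
`H` the chain matrix at `1`. -/
theorem stackRow_alphaCol_vecMul (hU : U ∈ Matrix.unitaryGroup (Fin (p + 1)) ℂ)
    (hV : V ∈ Matrix.unitaryGroup (Fin (p + 1)) ℂ) (hk : kEntry U ≠ kEntry V) :
    stackRow (alphaCol U) (alphaCol V) ᵥ* chainMatOne U V =
      ((star (kEntry U) - star (kEntry V)) / (kEntry U - kEntry V)) •
        Sum.elim (fun j => kEntry V * U (Fin.last p) j.succ)
          (fun j => -(kEntry U * V (Fin.last p) j.succ)) := by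
  have hd : kEntry U - kEntry V ≠ 0 := sub_ne_zero.2 hk
  have hexp (W : Matrix (Fin (p + 1)) (Fin (p + 1)) ℂ)
      (hW : W ∈ Matrix.unitaryGroup (Fin (p + 1)) ℂ) (e : ℂ) (j : Fin p) (r : ℂ) :
      ∑ l : Fin p, star (W l.castSucc 0) * (e * W l.castSucc j.succ + W l.castSucc 0 * r) =
        -(e * (star (kEntry W) * W (Fin.last p) j.succ)) +
          r * (1 - star (kEntry W) * kEntry W) := by
    have h3 := sum_star_mul_col hW 0 j.succ
    have h4 := sum_star_mul_col hW 0 0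
    rw [Matrix.one_apply_eq] at h4
    rw [Matrix.one_apply_ne (Fin.succ_ne_zero _).symm, zero_sub] at h3
    rw [kEntry, ← mul_neg, ← h3, ← h4, Finset.mul_sum, Finset.mul_sum, ← Finset.sum_add_distrib]
    exact Finset.sum_congr rfl fun l _ => by ring
  ext j
  rw [Matrix.vecMul, dotProduct, Fintype.sum_sum_type]
  rcases j with j | j
  · have e1 := hexp U hU 1 j (chainRowOne U V (Sum.inl j))
    have e2 := hexp V hV 0 j (chainRowOne U V (Sum.inl j))
    simp only [one_mul, zero_mul, zero_add] at e1 e2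
    simp only [stackRow, alphaCol, chainMatOne_apply, chainConst, Matrix.fromBlocks_apply₁₁,
      Matrix.fromBlocks_apply₂₁, chainCol, Sum.elim_inl, Sum.elim_inr, Matrix.of_apply,
      Matrix.zero_apply, zero_add, neg_mul, Finset.sum_neg_distrib, e1, e2]
    simp only [chainRowOne, Sum.elim_inl, Pi.smul_apply, smul_eq_mul]
    field_simp
    ring
  · have e1 := hexp U hU 0 j (chainRowOne U V (Sum.inr j))
    have e2 := hexp V hV 1 j (chainRowOne U V (Sum.inr j))
    simp only [one_mul, zero_mul, zero_add] at e1 e2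
    simp only [stackRow, alphaCol, chainMatOne_apply, chainConst, Matrix.fromBlocks_apply₁₂,
      Matrix.fromBlocks_apply₂₂, chainCol, Sum.elim_inl, Sum.elim_inr, Matrix.of_apply,
      Matrix.zero_apply, zero_add, neg_mul, Finset.sum_neg_distrib, e1, e2]
    simp only [chainRowOne, Sum.elim_inr, Pi.smul_apply, smul_eq_mul]
    field_simp
    ring

/-- The pole `k_V / k_U = 1 / w̄` dictates `w`; choosing `ξ = 1` makes `H` the value at `1`; `[u;
v]` is `[α_U; α_V]` rescaled to `‖u‖ = 1`. Then `‖v‖ < 1` since `‖α_U‖² - ‖α_V‖² = |k_V|² - |k_U|²`.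
-/
theorem exists_Theta_eq_chainMat (hU : U ∈ Matrix.unitaryGroup (Fin (p + 1)) ℂ)
    (hV : V ∈ Matrix.unitaryGroup (Fin (p + 1)) ℂ) (hk : ‖kEntry U‖ < ‖kEntry V‖) :
    ∃ (u v : EuclideanSpace ℂ (Fin p)) (w ξ : ℂ) (H : Matrix (Fin p ⊕ Fin p) (Fin p ⊕ Fin p) ℂ),
      IsThetaParam u v w ξ H ∧ Theta u v w ξ H = chainMat U V := by
  have hUn := norm_sq_alphaCol hU
  have hVn := norm_sq_alphaCol hV
  have hkne : kEntry U ≠ kEntry V := fun h => by rw [h] at hk; exact lt_irrefl _ hk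
  have hV1 : 0 ≤ 1 - ‖kEntry V‖ ^ 2 := by rw [← hVn]; positivity
  have hlt : ‖alphaCol V‖ ^ 2 < ‖alphaCol U‖ ^ 2 := by
    rw [hUn, hVn]; nlinarith [norm_nonneg (kEntry U)]
  have hlt' : ‖alphaCol V‖ < ‖alphaCol U‖ := lt_of_pow_lt_pow_left₀ 2 (norm_nonneg _) hlt
  have hpos : 0 < ‖alphaCol U‖ := (norm_nonneg _).trans_lt hlt'
  set t : ℂ := ((‖alphaCol U‖⁻¹ : ℝ) : ℂ) with ht
  have htn : ‖t‖ = ‖alphaCol U‖⁻¹ := by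
    rw [ht, Complex.norm_real, Real.norm_of_nonneg (by positivity)]
  set n : ℂ := star (kEntry V) * kEntry V - star (kEntry U) * kEntry U with hn
  have hn' : n = (‖alphaCol U‖ : ℂ) ^ 2 - (‖alphaCol V‖ : ℂ) ^ 2 := by
    rw [hn, RCLike.star_def, Complex.conj_mul', Complex.conj_mul',
      ← Complex.ofReal_pow, ← Complex.ofReal_pow, ← Complex.ofReal_pow, ← Complex.ofReal_pow,
      hUn, hVn]
    push_cast
    ring
  have hn0 : n ≠ 0 := by
    have : (‖alphaCol U‖ ^ 2 - ‖alphaCol V‖ ^ 2 : ℝ) ≠ 0 := by linarith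
    rw [hn']
    exact_mod_cast this
  have hproj : stackProj (t • alphaCol U) (t • alphaCol V) =
      n⁻¹ • Matrix.vecMulVec (chainCol U V) (stackRow (alphaCol U) (alphaCol V)) := by
    have hc : (‖alphaCol U‖ : ℂ) ≠ 0 := by exact_mod_cast hpos.ne'
    have e1 : stack (t • alphaCol U) (t • alphaCol V) = t • chainCol U V := by
      ext i
      rcases i with i | i <;> simp [stack, chainCol, alphaCol]
    have hts : star t = t := by rw [ht]; exact Complex.conj_ofReal _
    have e2 : stackRow (t • alphaCol U) (t • alphaCol V) =
        t • stackRow (alphaCol U) (alphaCol V) := by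
      ext i
      rcases i with i | i <;>
        simp only [stackRow, Sum.elim_inl, Sum.elim_inr, PiLp.smul_apply, smul_eq_mul, star_mul',
          hts, Pi.smul_apply, mul_neg]
    have e3 : (1 - (‖t • alphaCol V‖ : ℂ) ^ 2) = t ^ 2 * n := by
      rw [norm_smul, htn, hn', ht]
      push_cast
      field_simp
    have ht0 : t ≠ 0 := by
      rw [← norm_ne_zero_iff, htn]; positivity
    rw [stackProj, e1, e2, e3, Matrix.smul_vecMulVec, Matrix.vecMulVec_smul, smul_smul, smul_smul]
    congr 1
    field_simp
  refine ⟨t • alphaCol U, t • alphaCol V, star (kEntry U / kEntry V), 1, chainMatOne U V,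
    ⟨?_, ?_, ?_, norm_one, isJUnitary_chainMatOne hU hV hkne⟩, ?_⟩
  · rw [norm_star, norm_div, div_lt_one ((norm_nonneg _).trans_lt hk)]
    exact hk
  · rw [norm_smul, htn, inv_mul_cancel₀ hpos.ne']
  · rw [norm_smul, htn, inv_mul_lt_iff₀ hpos, mul_one]
    exact hlt'
  · have hd : kEntry U - kEntry V ≠ 0 := sub_ne_zero.2 hkne
    have hd' : star (kEntry U) - star (kEntry V) ≠ 0 := by
      rw [← star_sub]; exact star_ne_zero.2 hd
    have cd : (C (kEntry U) - C (kEntry V) : RatFunc ℂ) ≠ 0 := by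
      rw [← map_sub]; exact (map_ne_zero _).2 hd
    have cd' : (C (star (kEntry U)) - C (star (kEntry V)) : RatFunc ℂ) ≠ 0 := by
      rw [← map_sub]; exact (map_ne_zero _).2 hd'
    have cn : (C n : RatFunc ℂ) ≠ 0 := (map_ne_zero _).2 hn0
    have hq : chainDenom U V ≠ 0 := chainDenom_ne_zero fun h => by
      rw [h.1, h.2] at hk; exact lt_irrefl _ hk
    have hqd : chainDenom U V = X * C (kEntry U) - C (kEntry V) := rfl
    ext i j
    rw [Theta_apply, chainMat_apply, hproj, Matrix.smul_mul, Matrix.vecMulVec_mul,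
      stackRow_alphaCol_vecMul hU hV hkne, blaschke_div_blaschkeAt_one_sub_one hk, ← hn,
      chainMatOne_apply, ← hqd]
    simp only [Matrix.smul_apply, Matrix.vecMulVec_apply, Pi.smul_apply, smul_eq_mul, map_mul,
      map_add, map_sub, map_div₀, map_inv₀]
    -- The constant part `diag(M_U, M_V)` is common to both sides; only the rank one terms remain.
    rw [add_assoc]
    congr 1
    rcases j with j | j
    · simp only [chainRowOne, chainRow, Sum.elim_inl, map_div₀, map_sub, map_neg, map_mul]
      field_simp
      rw [hqd]
      ring
    · simp only [chainRowOne, chainRow, Sum.elim_inr, map_div₀, map_sub, map_neg, map_mul]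
      field_simp
      rw [hqd]
      ring

end existence

/-! ### Necessity for `p > 1` -/

section necessity

variable {p : ℕ} {U V : Matrix (Fin (p + 1)) (Fin (p + 1)) ℂ}

theorem eq_zero_of_quadratic {a b c : ℂ} (h : (C a * X ^ 2 + C b * X + C c : RatFunc ℂ) = 0) :
    a = 0 ∧ b = 0 ∧ c = 0 := by
  have h1 : algebraMap (Polynomial ℂ) (RatFunc ℂ) (Polynomial.C a * Polynomial.X ^ 2 +
      Polynomial.C b * Polynomial.X + Polynomial.C c) = 0 := by
    rwa [map_add, map_add, map_mul, map_mul, map_pow, RatFunc.algebraMap_X, RatFunc.algebraMap_C,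
      RatFunc.algebraMap_C, RatFunc.algebraMap_C]
  rw [map_eq_zero_iff _ (RatFunc.algebraMap_injective ℂ)] at h1
  have e0 := congrArg (Polynomial.eval 0) h1
  have e1 := congrArg (Polynomial.eval 1) h1
  have e2 := congrArg (Polynomial.eval (-1)) h1
  simp only [Polynomial.eval_add, Polynomial.eval_mul, Polynomial.eval_pow, Polynomial.eval_X,
    Polynomial.eval_C, Polynomial.eval_zero] at e0 e1 e2
  refine ⟨?_, ?_, ?_⟩
  · linear_combination (e1 + e2) / 2 - e0
  · linear_combination (e1 - e2) / 2
  · linear_combination e0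

/-- At `z = 1 / w̄` the left side vanishes and `z - w` does not, so `z a - b` must vanish. Working
with coefficients includes the case `w = 0`. -/
theorem eq_star_mul_of_quadratic {a b w k B D : ℂ} (hw : ‖w‖ < 1) (hk : k ≠ 0)
    (h : ((1 - C (star w) * X) * (C B * X + C D) : RatFunc ℂ) =
      C k * (X * C a - C b) * (X - C w)) : a = star w * b := by
  have h1 : (C (-(star w) * B - k * a) * X ^ 2 + C (B - star w * D + k * b + k * a * w) * X +
      C (D - k * b * w) : RatFunc ℂ) = 0 := by
    simp only [map_sub, map_add, map_mul, map_neg]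
    linear_combination h
  obtain ⟨h2, h3, h4⟩ := eq_zero_of_quadratic h1
  -- Evaluation of the quadratic at `1 / w̄`, multiplied by `w̄²`.
  have h5 : k * (1 - star w * w) * (a - star w * b) = 0 := by
    linear_combination -h2 - star w * h3 - star w * star w * h4
  have h6 := (mul_eq_zero.1 h5).resolve_left
    (mul_ne_zero hk (one_sub_star_mul_self_ne_zero hw))
  linear_combination h6

theorem C_comp_vecMul_constMat {m n : Type*} [Fintype m] (l : m → ℂ) (A : Matrix m n ℂ) :
    (C ∘ l : m → RatFunc ℂ) ᵥ* constMat A = C ∘ (l ᵥ* A) := by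
  ext j
  simp [Matrix.vecMul, dotProduct, constMat_apply]

theorem exists_ne_zero_dotProduct_eq_zero {n : Type*} [Fintype n] (hn : 2 < Fintype.card n)
    (x y : n → ℂ) : ∃ l : n → ℂ, l ≠ 0 ∧ l ⬝ᵥ x = 0 ∧ l ⬝ᵥ y = 0 := by
  have h := LinearMap.ker_ne_bot_of_finrank_lt
    (f := (Matrix.of ![x, y] : Matrix (Fin 2) n ℂ).mulVecLin) (by simpa using hn)
  obtain ⟨l, hl, hl0⟩ := (Submodule.ne_bot_iff _).1 h
  rw [LinearMap.mem_ker, Matrix.mulVecLin_apply] at hl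
  refine ⟨l, hl0, ?_, ?_⟩
  · rw [dotProduct_comm]; exact congrFun hl 0
  · rw [dotProduct_comm]; exact congrFun hl 1

theorem stackProj_ne_zero {u v : EuclideanSpace ℂ (Fin p)} (hu : ‖u‖ = 1) (hv : ‖v‖ < 1) :
    stackProj u v ≠ 0 := by
  intro h
  have hu0 : u = 0 := by
    ext i
    have h1 := congrFun (congrFun h (Sum.inl i)) (Sum.inl i)
    simpa [stackProj, Matrix.vecMulVec_apply, stack, stackRow, one_sub_norm_sq_ne_zero hv] using h1
  simp [hu0] at hu

/-- Both sides are built from a constant matrix plus a rank one term with constant column. As `2p >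
2`, a nonzero row `l` kills both columns, leaving `l diag(M_U, M_V) = φ l H` with `l H ≠ 0`. -/
theorem exists_eq_C_of_chainMat_eq_smul (hp : 1 < p) {φ : RatFunc ℂ} (hφ : φ ≠ 0)
    {u v : EuclideanSpace ℂ (Fin p)} {w ξ : ℂ} {H : Matrix (Fin p ⊕ Fin p) (Fin p ⊕ Fin p) ℂ}
    (hpar : IsThetaParam u v w ξ H) (h : chainMat U V = φ • Theta u v w ξ H) :
    ∃ c : ℂ, c ≠ 0 ∧ φ = C c := by
  obtain ⟨l, hl0, hlx, hly⟩ := exists_ne_zero_dotProduct_eq_zero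
    (by rw [Fintype.card_sum, Fintype.card_fin]; omega) (chainCol U V) (stack u v)
  have h1 := congrArg ((C ∘ l : Fin p ⊕ Fin p → RatFunc ℂ) ᵥ* ·) h
  have hx : (C ∘ l : Fin p ⊕ Fin p → RatFunc ℂ) ⬝ᵥ (C ∘ chainCol U V) = 0 := by
    rw [← map_zero C, ← hlx]
    simp [dotProduct]
  have hP : l ᵥ* stackProj u v = 0 := by
    rw [stackProj, Matrix.vecMul_smul, Matrix.vecMul_vecMulVec, hly, zero_smul, smul_zero]
  have hΘ : Theta u v w ξ H = constMat H +
      (blaschke w / C (blaschkeAt w ξ) - 1) • constMat (stackProj u v * H) := by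
    ext i j
    rw [Theta_apply]
    rfl
  simp only [chainMat, hΘ, Matrix.vecMul_add, Matrix.vecMul_smul, C_comp_vecMul_constMat,
    Matrix.vecMul_vecMulVec, hx, zero_smul, add_zero, ← Matrix.vecMul_vecMul, hP,
    Matrix.zero_vecMul] at h1
  have hlH : l ᵥ* H ≠ 0 := fun h0 => hl0 <| by
    apply Matrix.vecMul_injective_of_isUnit hpar.junitary.isUnit
    simpa using h0
  obtain ⟨j, hj⟩ := Function.ne_iff.1 hlH
  have h2 := congrFun h1 j
  simp only [Function.comp_apply, Pi.smul_apply, Pi.add_apply, Pi.zero_apply, map_zero,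
    smul_eq_mul, mul_zero, add_zero] at h2
  have hj' : (C ((l ᵥ* H) j) : RatFunc ℂ) ≠ 0 := (map_ne_zero _).2 hj
  have hφc : φ = C ((l ᵥ* chainConst U V) j / (l ᵥ* H) j) := by
    rw [map_div₀, eq_div_iff hj']
    exact h2.symm
  exact ⟨_, fun h0 => hφ (by rw [hφc, h0, map_zero]), hφc⟩

/-- With a constant scalar, any nonzero entry `m` of `P H` exhibits the Blaschke factor, whose pole
must come from `z k_U - k_V`. -/
theorem norm_kEntry_lt_of_chainMat_eq_smul (hp : 1 < p) (hk : ¬(kEntry U = 0 ∧ kEntry V = 0))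
    {φ : RatFunc ℂ} (hφ : φ ≠ 0)
    {u v : EuclideanSpace ℂ (Fin p)} {w ξ : ℂ} {H : Matrix (Fin p ⊕ Fin p) (Fin p ⊕ Fin p) ℂ}
    (hpar : IsThetaParam u v w ξ H) (h : chainMat U V = φ • Theta u v w ξ H) :
    ‖kEntry U‖ < ‖kEntry V‖ := by
  obtain ⟨c, hc, rfl⟩ := exists_eq_C_of_chainMat_eq_smul hp hφ hpar h
  have hPH : stackProj u v * H ≠ 0 := fun h0 => stackProj_ne_zero hpar.norm_u hpar.norm_v <| by
    obtain ⟨H', hH', -⟩ := isUnit_iff_exists.1 hpar.junitary.isUnit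
    rw [← Matrix.mul_one (stackProj u v), ← hH', ← Matrix.mul_assoc, h0, Matrix.zero_mul]
  obtain ⟨i, hi⟩ := Function.ne_iff.1 hPH
  obtain ⟨j, hm⟩ := Function.ne_iff.1 hi
  set m := (stackProj u v * H) i j with hmd
  replace hm : m ≠ 0 := hm
  set β := blaschkeAt w ξ with hβ
  have hβ0 : β ≠ 0 := blaschkeAt_ne_zero hpar.norm_w hpar.norm_xi
  have hq := chainDenom_ne_zero hk
  have hrow : ∃ e f : ℂ, chainRow U V j = (C e * X + C f) / chainDenom U V := by
    rcases j with j | j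
    · exact ⟨-U (Fin.last p) j.succ, 0, by simp [chainRow, mul_comm]⟩
    · exact ⟨0, V (Fin.last p) j.succ, by simp [chainRow]⟩
  obtain ⟨e, f, hef⟩ := hrow
  have h1 := congrFun (congrFun h i) j
  rw [Matrix.smul_apply, Theta_apply, chainMat_apply, hef, ← hmd, ← hβ, smul_eq_mul,
    blaschke] at h1
  have hw := blaschke_denom_ne_zero w
  have cβ : (C β : RatFunc ℂ) ≠ 0 := (map_ne_zero _).2 hβ0
  have hqd : chainDenom U V = X * C (kEntry U) - C (kEntry V) := rfl
  obtain ⟨d, hd⟩ : ∃ d : RatFunc ℂ, d = 1 - C (star w) * X := ⟨_, rfl⟩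
  rw [← hd] at h1 hw
  field_simp at h1
  have heq : kEntry U = star w * kEntry V := by
    -- `B z + D` is `b_w(ξ) (z k_U - k_V)` times all the terms without `b_w(z)`, moved to the left
    -- side.
    refine eq_star_mul_of_quadratic (k := c * m)
      (B := (chainConst U V i j * kEntry U + chainCol U V i * e - c * (H i j - m) * kEntry U) * β)
      (D := (-(chainConst U V i j * kEntry V) + chainCol U V i * f +
        c * (H i j - m) * kEntry V) * β) hpar.norm_w (mul_ne_zero hc hm) ?_
    rw [← hd]
    simp only [map_sub, map_add, map_mul, map_neg]
    rw [hqd] at h1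
    linear_combination h1
  have hV0 : kEntry V ≠ 0 := fun h0 => hk ⟨by rw [heq, h0, mul_zero], h0⟩
  rw [heq, norm_mul, norm_star]
  exact mul_lt_of_lt_one_left (norm_pos_iff.2 hV0) hpar.norm_w

end necessity

/-! ### The case `p = 1` -/

section scalar

/-- Parity of the order at `w`: odd on the left, zero on the right because `1 - |w|² ≠ 0`. -/
theorem sq_mul_X_sub_C_ne {w t : ℂ} (hw : ‖w‖ < 1) (ht : t ≠ 0) (φ : RatFunc ℂ) :
    φ ^ 2 * (X - C w) ≠ C t * (1 - C (star w) * X) := by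
  intro h
  have hd0 : φ.denom ≠ 0 := RatFunc.denom_ne_zero φ
  have cd0 : algebraMap (Polynomial ℂ) (RatFunc ℂ) φ.denom ≠ 0 :=
    RatFunc.algebraMap_ne_zero hd0
  have h1 : φ.num * φ.num * (Polynomial.X - Polynomial.C w) =
      Polynomial.C t * (1 - Polynomial.C (star w) * Polynomial.X) * (φ.denom * φ.denom) := by
    apply RatFunc.algebraMap_injective ℂ
    rw [← RatFunc.num_div_denom φ] at h
    simp only [map_mul, map_sub, map_one, RatFunc.algebraMap_X, RatFunc.algebraMap_C]
    rw [div_pow, div_mul_eq_mul_div, div_eq_iff (pow_ne_zero 2 cd0)] at h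
    linear_combination h
  set L : Polynomial ℂ := Polynomial.C t * (1 - Polynomial.C (star w) * Polynomial.X) with hL
  have hLr : ¬L.IsRoot w := by
    rw [Polynomial.IsRoot, hL, Polynomial.eval_mul, Polynomial.eval_sub, Polynomial.eval_mul,
      Polynomial.eval_C, Polynomial.eval_C, Polynomial.eval_X, Polynomial.eval_one]
    exact mul_ne_zero ht (one_sub_star_mul_self_ne_zero hw)
  have hL0 : L ≠ 0 := fun h0 => hLr (by rw [h0]; exact Polynomial.eval_zero)
  have hR0 : L * (φ.denom * φ.denom) ≠ 0 := mul_ne_zero hL0 (mul_ne_zero hd0 hd0)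
  have hl0 := hR0
  rw [← h1] at hl0
  have h2 := congrArg (Polynomial.rootMultiplicity w) h1
  rw [Polynomial.rootMultiplicity_mul hl0,
    Polynomial.rootMultiplicity_mul (left_ne_zero_of_mul hl0),
    Polynomial.rootMultiplicity_mul hR0, Polynomial.rootMultiplicity_mul (mul_ne_zero hd0 hd0),
    Polynomial.rootMultiplicity_X_sub_C_self, Polynomial.rootMultiplicity_eq_zero hLr] at h2
  omega

theorem det_fin_one_sum {R : Type*} [CommRing R] (M : Matrix (Fin 1 ⊕ Fin 1) (Fin 1 ⊕ Fin 1) R) :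
    M.det = M (Sum.inl 0) (Sum.inl 0) * M (Sum.inr 0) (Sum.inr 0) -
      M (Sum.inl 0) (Sum.inr 0) * M (Sum.inr 0) (Sum.inl 0) := by
  rw [← Matrix.det_reindex_self finSumFinEquiv, Matrix.det_fin_two]
  rfl

variable {U V : Matrix (Fin (1 + 1)) (Fin (1 + 1)) ℂ}

/-- A rank one projection has trace `1` (`htr`), so `det (1 + (b - 1) P) = b`. -/
theorem det_Theta {u v : EuclideanSpace ℂ (Fin 1)} {w ξ : ℂ}
    {H : Matrix (Fin 1 ⊕ Fin 1) (Fin 1 ⊕ Fin 1) ℂ} (h : IsThetaParam u v w ξ H) :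
    (Theta u v w ξ H).det = blaschke w / C (blaschkeAt w ξ) * C H.det := by
  have hn := one_sub_norm_sq_ne_zero h.norm_v
  have hdot := stackRow_dotProduct_stack u v
  rw [h.norm_u, dotProduct, Fintype.sum_sum_type, Fin.sum_univ_one, Fin.sum_univ_one] at hdot
  have htr : C ((1 - (‖v‖ : ℂ) ^ 2)⁻¹) * (C (stack u v (Sum.inl 0)) * C (stackRow u v (Sum.inl 0))
      + C (stack u v (Sum.inr 0)) * C (stackRow u v (Sum.inr 0))) = (1 : RatFunc ℂ) := by
    simp only [← map_mul, ← map_add]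
    rw [← map_one C]
    congr 1
    rw [inv_mul_eq_div, div_eq_one_iff_eq hn]
    rw [Complex.ofReal_one, one_pow] at hdot
    rw [← hdot]
    ring
  have hdH : (constMat H).det = C H.det := (RingHom.map_det _ _).symm
  rw [Theta_eq, Matrix.det_mul, hdH]
  congr 1
  rw [det_fin_one_sum]
  simp only [Matrix.add_apply, Matrix.smul_apply, constMat_apply, stackProj, Matrix.one_apply,
    Matrix.vecMulVec_apply, smul_eq_mul, map_mul, reduceCtorEq, if_true, if_false]
  linear_combination (blaschke w / C (blaschkeAt w ξ) - 1) * htr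

/-- Compare the two forms `U*` and `adj U / det U` of the inverse. -/
theorem unitary_two_apply_zero_one {U : Matrix (Fin 2) (Fin 2) ℂ}
    (hU : U ∈ Matrix.unitaryGroup (Fin 2) ℂ) : U 0 1 = -(star (U 1 0) * U.det) := by
  have h1 := Matrix.mem_unitaryGroup_iff'.1 hU
  have h00 := congrFun (congrFun h1 0) 0
  have h01 := congrFun (congrFun h1 0) 1
  simp only [Matrix.mul_apply, Fin.sum_univ_two, Matrix.star_apply, Matrix.one_apply] at h00 h01
  simp only [if_true, zero_ne_one, if_false] at h00 h01
  rw [Matrix.det_fin_two]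
  linear_combination -U 0 1 * h00 + U 0 0 * h01

theorem det_ne_zero_of_mem_unitaryGroup (hU : U ∈ Matrix.unitaryGroup (Fin (1 + 1)) ℂ) :
    U.det ≠ 0 := fun h => by
  have h1 := congrArg Matrix.det (Matrix.mem_unitaryGroup_iff.1 hU)
  rw [Matrix.det_mul, h, zero_mul, Matrix.det_one] at h1
  exact zero_ne_one h1

/-- Numerator and denominator are reflections of each other, so they are proportional when `|k_U| =
|k_V| ≠ 0`, and the determinant is then constant. -/
theorem det_chainMat (hU : U ∈ Matrix.unitaryGroup (Fin (1 + 1)) ℂ)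
    (hV : V ∈ Matrix.unitaryGroup (Fin (1 + 1)) ℂ) (hk : ¬(kEntry U = 0 ∧ kEntry V = 0)) :
    (chainMat U V).det * chainDenom U V =
      C (U.det * V.det) * (C (star (kEntry V)) * X - C (star (kEntry U))) := by
  have hq := chainDenom_ne_zero hk
  have eU : kEntry U = U 1 0 := rfl
  have eV : kEntry V = V 1 0 := rfl
  have cU := congrArg (C : ℂ →+* RatFunc ℂ) (unitary_two_apply_zero_one hU)
  have cV := congrArg (C : ℂ →+* RatFunc ℂ) (unitary_two_apply_zero_one hV)
  have dU := congrArg (C : ℂ →+* RatFunc ℂ) (Matrix.det_fin_two U)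
  have dV := congrArg (C : ℂ →+* RatFunc ℂ) (Matrix.det_fin_two V)
  rw [det_fin_one_sum]
  have hqd : chainDenom U V = X * C (kEntry U) - C (kEntry V) := rfl
  simp only [chainMat_apply, chainConst, chainCol, chainRow, Matrix.fromBlocks_apply₁₁,
    Matrix.fromBlocks_apply₁₂, Matrix.fromBlocks_apply₂₁, Matrix.fromBlocks_apply₂₂, Sum.elim_inl,
    Sum.elim_inr, Matrix.of_apply, Matrix.zero_apply, map_zero, zero_add]
  have l1 : (Fin.last 1 : Fin (1 + 1)) = 1 := rfl
  have l2 : (Fin.succ 0 : Fin (1 + 1)) = 1 := rfl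
  have l3 : (Fin.castSucc 0 : Fin (1 + 1)) = 0 := rfl
  simp only [l1, l2, l3]
  have e : (C (U 0 1) + C (U 0 0) * (-(X * C (U 1 1)) / chainDenom U V)) *
        (C (V 0 1) + C (V 0 0) * (C (V 1 1) / chainDenom U V)) -
      C (U 0 0) * (C (V 1 1) / chainDenom U V) *
        (C (V 0 0) * (-(X * C (U 1 1)) / chainDenom U V)) =
      C (U 0 1) * C (V 0 1) + (C (U 0 1) * C (V 0 0) * C (V 1 1) -
        C (V 0 1) * C (U 0 0) * X * C (U 1 1)) / chainDenom U V := by ring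
  rw [e, add_mul, div_mul_cancel₀ _ hq, hqd, eU, eV]
  simp only [map_mul, map_sub, map_neg] at cU cV dU dV ⊢
  linear_combination X * C (V 0 1) * dU - C (U 0 1) * dV + C V.det * cU - X * C U.det * cV

theorem norm_kEntry_ne_of_chainMat_eq_smul (hU : U ∈ Matrix.unitaryGroup (Fin (1 + 1)) ℂ)
    (hV : V ∈ Matrix.unitaryGroup (Fin (1 + 1)) ℂ) (hk : ¬(kEntry U = 0 ∧ kEntry V = 0))
    {φ : RatFunc ℂ} {u v : EuclideanSpace ℂ (Fin 1)} {w ξ : ℂ}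
    {H : Matrix (Fin 1 ⊕ Fin 1) (Fin 1 ⊕ Fin 1) ℂ}
    (hpar : IsThetaParam u v w ξ H) (h : chainMat U V = φ • Theta u v w ξ H) :
    ‖kEntry U‖ ≠ ‖kEntry V‖ := by
  intro hn
  have hU0 : kEntry U ≠ 0 := fun h0 => hk ⟨h0, by
    rw [h0, norm_zero] at hn; exact norm_eq_zero.1 hn.symm⟩
  have hV0 : kEntry V ≠ 0 := fun h0 => hU0 (by rw [h0, norm_zero] at hn; exact norm_eq_zero.1 hn)
  have hss : star (kEntry U) * kEntry U = star (kEntry V) * kEntry V := by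
    rw [RCLike.star_def, Complex.conj_mul', Complex.conj_mul', hn]
  have hdet := det_chainMat hU hV hk
  have hq := chainDenom_ne_zero hk
  have hHd : H.det ≠ 0 := ((Matrix.isUnit_iff_isUnit_det _).1 hpar.junitary.isUnit).ne_zero
  have hβ := blaschkeAt_ne_zero hpar.norm_w hpar.norm_xi
  have cβ : (C (blaschkeAt w ξ) : RatFunc ℂ) ≠ 0 := (map_ne_zero _).2 hβ
  have cU0 : (C (kEntry U) : RatFunc ℂ) ≠ 0 := (map_ne_zero _).2 hU0
  have cHd : (C H.det : RatFunc ℂ) ≠ 0 := (map_ne_zero _).2 hHd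
  have hw := blaschke_denom_ne_zero w
  have hconst : (chainMat U V).det = C (U.det * V.det * star (kEntry V) / kEntry U) := by
    apply mul_right_cancel₀ hq
    rw [hdet, map_div₀, div_mul_eq_mul_div, eq_div_iff cU0]
    have hs := congrArg (C : ℂ →+* RatFunc ℂ) hss
    simp only [map_mul, chainDenom] at hs ⊢
    linear_combination -(C U.det * C V.det) * hs
  rw [h, Matrix.det_smul, det_Theta hpar, Fintype.card_sum, Fintype.card_fin, blaschke] at hconst
  refine sq_mul_X_sub_C_ne hpar.norm_w (t := U.det * V.det * star (kEntry V) / kEntry U *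
    blaschkeAt w ξ / H.det) ?_ φ ?_
  · exact div_ne_zero (mul_ne_zero (div_ne_zero (mul_ne_zero (mul_ne_zero
      (det_ne_zero_of_mem_unitaryGroup hU) (det_ne_zero_of_mem_unitaryGroup hV))
      (star_ne_zero.2 hV0)) hU0) hβ) hHd
  · rw [map_div₀ _ _ H.det, map_mul, ← hconst]
    obtain ⟨d, hd⟩ : ∃ d : RatFunc ℂ, d = 1 - C (star w) * X := ⟨_, rfl⟩
    rw [← hd] at hw ⊢
    field_simp
    ring

theorem IsJUnitary.submatrix_swap {p : ℕ} {H : Matrix (Fin p ⊕ Fin p) (Fin p ⊕ Fin p) ℂ}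
    (h : IsJUnitary H) : IsJUnitary (H.submatrix Sum.swap Sum.swap) := by
  have hJ : sigJ p = -(sigJ p).submatrix Sum.swap Sum.swap := by
    ext i j
    rcases i with i | i <;> rcases j with j | j <;> simp [sigJ]
  have h1 := congrArg (fun M => M.submatrix (Equiv.sumComm (Fin p) (Fin p))
    (Equiv.sumComm (Fin p) (Fin p))) h
  have e : (Equiv.sumComm (Fin p) (Fin p) : Fin p ⊕ Fin p → Fin p ⊕ Fin p) = Sum.swap := rfl
  simp only [← Matrix.submatrix_mul_equiv _ _ _ (Equiv.sumComm (Fin p) (Fin p)) _, e] at h1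
  rw [IsJUnitary, hJ, Matrix.conjTranspose_submatrix, Matrix.mul_neg, Matrix.neg_mul, h1]

/-- For `p = 1`, `circ` maps an elementary factor to a scalar multiple of one. -/
theorem exists_circ_Theta_eq_smul {u v : EuclideanSpace ℂ (Fin 1)} {w ξ : ℂ}
    {H : Matrix (Fin 1 ⊕ Fin 1) (Fin 1 ⊕ Fin 1) ℂ} (h : IsThetaParam u v w ξ H) :
    ∃ (φ : RatFunc ℂ) (u' v' : EuclideanSpace ℂ (Fin 1)) (w' ξ' : ℂ)
      (H' : Matrix (Fin 1 ⊕ Fin 1) (Fin 1 ⊕ Fin 1) ℂ), φ ≠ 0 ∧ IsThetaParam u' v' w' ξ' H' ∧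
      circ (Theta u v w ξ H) = φ • Theta u' v' w' ξ' H' := by
  set u' : EuclideanSpace ℂ (Fin 1) := WithLp.toLp 2 fun i => star (u i) with hu'
  set v' : EuclideanSpace ℂ (Fin 1) := WithLp.toLp 2 fun i => star (v i) with hv'
  have nu : ‖u'‖ = ‖u‖ := by simp [EuclideanSpace.norm_eq, hu']
  have nv : ‖v'‖ = ‖v‖ := by simp [EuclideanSpace.norm_eq, hv']
  have hpar : IsThetaParam u' v' (star w) (star ξ) (H.submatrix Sum.swap Sum.swap) :=
    ⟨by rw [norm_star]; exact h.norm_w, by rw [nu, h.norm_u], by rw [nv]; exact h.norm_v,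
      by rw [norm_star, h.norm_xi], h.junitary.submatrix_swap⟩
  have hn := one_sub_norm_sq_ne_zero h.norm_v
  -- In dimension two the complementary projection has rank one; swapping the coordinates makes it
  -- `J`-positive again, with conjugated vectors.
  have hproj : stackProj u' v' = 1 - (stackProj u v).submatrix Sum.swap Sum.swap := by
    have hdot := stackRow_dotProduct_stack u v
    rw [h.norm_u, dotProduct, Fintype.sum_sum_type, Fin.sum_univ_one, Fin.sum_univ_one] at hdot
    have hu1 : star (u 0) * u 0 = 1 := by
      have hu2 := EuclideanSpace.norm_sq_eq u
      rw [h.norm_u, Fin.sum_univ_one] at hu2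
      rw [RCLike.star_def, Complex.conj_mul', ← Complex.ofReal_pow, ← hu2]
      norm_num
    simp only [stackRow, stack, Sum.elim_inl, Sum.elim_inr, hu1, Complex.ofReal_one] at hdot
    have hnv : 1 - (‖v‖ : ℂ) ^ 2 = 1 - star (v 0) * v 0 := by linear_combination -hdot
    have hinv := inv_mul_cancel₀ hn
    rw [stackProj, stackProj, nv]
    rw [hnv] at hinv ⊢
    have e1 : u' 0 = star (u 0) := rfl
    have e2 : v' 0 = star (v 0) := rfl
    ext i j
    rcases i with i | i <;> rcases j with j | j <;> obtain rfl := Subsingleton.elim i 0 <;>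
      obtain rfl := Subsingleton.elim j 0 <;>
      simp only [Matrix.sub_apply, Matrix.submatrix_apply, Sum.swap_inl, Sum.swap_inr,
        Matrix.smul_apply, Matrix.vecMulVec_apply, stack, stackRow, Sum.elim_inl, Sum.elim_inr,
        smul_eq_mul, Matrix.one_apply_eq, e1, e2, star_star, ne_eq, reduceCtorEq,
        not_false_eq_true, Matrix.one_apply_ne]
    · linear_combination (1 - star (v 0) * v 0)⁻¹ * hu1 + hinv
    · ring
    · ring
    · linear_combination (1 - star (v 0) * v 0)⁻¹ * hu1 + hinv
  have hξ : star ξ * ξ = 1 := by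
    rw [RCLike.star_def, Complex.conj_mul', h.norm_xi]
    norm_num
  have hβ0 := blaschkeAt_ne_zero h.norm_w h.norm_xi
  have hβ0' := blaschkeAt_ne_zero hpar.norm_w hpar.norm_xi
  have hβ : blaschkeAt (star w) (star ξ) = (blaschkeAt w ξ)⁻¹ := by
    have h1 := (div_ne_zero_iff.1 hβ0).1
    have h2 := (div_ne_zero_iff.1 hβ0').2
    rw [blaschkeAt, blaschkeAt, inv_div, div_eq_div_iff h2 h1, star_star]
    linear_combination (1 - star w * w) * hξ
  -- The identity `b_w(1/z) = 1 / b_{w̄}(z)`.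
  have hsub : substInvHom (blaschke w / C (blaschkeAt w ξ)) =
      (blaschke (star w) / C (blaschkeAt (star w) (star ξ)))⁻¹ := by
    have hX := RatFunc.X_ne_zero (K := ℂ)
    have h1 := X_sub_C_ne_zero (star w)
    have h2 : (1 - C (star w) * X⁻¹ : RatFunc ℂ) ≠ 0 := by
      intro h0
      apply h1
      field_simp at h0
      rwa [mul_zero] at h0
    have h3 : substInvHom (blaschke w) = (blaschke (star w))⁻¹ := by
      simp only [blaschke, map_div₀, map_sub, map_mul, map_one, substInvHom_C, substInvHom_X,
        star_star, inv_div]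
      rw [div_eq_div_iff h2 h1]
      field_simp
    rw [map_div₀, h3, substInvHom_C, hβ, map_inv₀, inv_div, div_eq_mul_inv, div_eq_mul_inv,
      mul_comm]
  have hb0 : blaschke (star w) / C (blaschkeAt (star w) (star ξ)) ≠ 0 :=
    div_ne_zero (blaschke_ne_zero _) ((map_ne_zero _).2 hβ0')
  -- The scalar is `b⁻¹`, from `1 + (b⁻¹ - 1)(1 - P') = b⁻¹ (1 + (b - 1) P')`.
  refine ⟨_, u', v', star w, star ξ, _, inv_ne_zero hb0, hpar, ?_⟩
  have hprod (i j : Fin 1 ⊕ Fin 1) :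
      (stackProj u' v' * H.submatrix Sum.swap Sum.swap) i j =
        H i.swap j.swap - (stackProj u v * H) i.swap j.swap := by
    have e : (stackProj u v).submatrix Sum.swap Sum.swap * H.submatrix Sum.swap Sum.swap =
        (stackProj u v * H).submatrix Sum.swap Sum.swap :=
      Matrix.submatrix_mul_equiv _ _ _ (Equiv.sumComm (Fin 1) (Fin 1)) _
    rw [hproj, Matrix.sub_mul, Matrix.one_mul, e]
    rfl
  ext i j
  rw [circ_apply, Theta_apply, Matrix.smul_apply, Theta_apply, hprod, map_add, map_mul, map_sub,
    hsub, map_one, substInvHom_C, substInvHom_C, Matrix.submatrix_apply, map_sub, smul_eq_mul]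
  generalize blaschke (star w) / C (blaschkeAt (star w) (star ξ)) = b at hb0 ⊢
  field_simp
  ring

end scalar

/-! ### Representability -/

section representability

variable {p : ℕ} {U V : Matrix (Fin (p + 1)) (Fin (p + 1)) ℂ}

theorem hasThetaRep_of_lt (hU : U ∈ Matrix.unitaryGroup (Fin (p + 1)) ℂ)
    (hV : V ∈ Matrix.unitaryGroup (Fin (p + 1)) ℂ) (hk : ‖kEntry U‖ < ‖kEntry V‖) :
    HasThetaRep (FUV U V) := by
  obtain ⟨u, v, w, ξ, H, hpar, h⟩ := exists_Theta_eq_chainMat hU hV hk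
  refine ⟨u, v, w, ξ, H, hpar, ?_⟩
  rw [h]
  exact representedBy_chainMat hU hV fun h0 => by rw [h0.1, h0.2] at hk; exact lt_irrefl _ hk

theorem hasThetaCircRep_of_lt (hU : U ∈ Matrix.unitaryGroup (Fin (p + 1)) ℂ)
    (hV : V ∈ Matrix.unitaryGroup (Fin (p + 1)) ℂ) (hk : ‖kEntry V‖ < ‖kEntry U‖) :
    HasThetaCircRep (FUV U V) := by
  obtain ⟨u, v, w, ξ, H, hpar, h⟩ := exists_Theta_eq_chainMat hV hU hk
  refine ⟨u, v, w, ξ, H, hpar, ?_⟩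
  rw [h, circ_chainMat]
  exact representedBy_chainMat hU hV fun h0 => by rw [h0.1, h0.2] at hk; exact lt_irrefl _ hk

theorem HasThetaRep.exists_chainMat_eq_smul (hp : 0 < p)
    (hU : U ∈ Matrix.unitaryGroup (Fin (p + 1)) ℂ)
    (hV : V ∈ Matrix.unitaryGroup (Fin (p + 1)) ℂ) (h : HasThetaRep (FUV U V)) :
    ¬(kEntry U = 0 ∧ kEntry V = 0) ∧ ∃ (φ : RatFunc ℂ) (u v : EuclideanSpace ℂ (Fin p)) (w ξ : ℂ)
      (H : Matrix (Fin p ⊕ Fin p) (Fin p ⊕ Fin p) ℂ), φ ≠ 0 ∧ IsThetaParam u v w ξ H ∧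
      chainMat U V = φ • Theta u v w ξ H := by
  obtain ⟨u, v, w, ξ, H, hpar, hr⟩ := h
  have hk : ¬(kEntry U = 0 ∧ kEntry V = 0) := fun h0 =>
    not_representedBy_of_kEntry_eq_zero hV h0.1 h0.2 hpar.isUnit_Theta hr
  obtain ⟨φ, hφ, he⟩ := eq_smul_of_representedBy hp (representedBy_chainMat hU hV hk) hr
    hpar.isUnit_Theta
  exact ⟨hk, φ, u, v, w, ξ, H, hφ, hpar, he⟩

/-- Uniqueness is applied to `circ (Theta u v w ξ H)`; a further `circ` then exchanges `U` and `V`.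
-/
theorem HasThetaCircRep.exists_chainMat_eq_smul (hp : 0 < p)
    (hU : U ∈ Matrix.unitaryGroup (Fin (p + 1)) ℂ)
    (hV : V ∈ Matrix.unitaryGroup (Fin (p + 1)) ℂ) (h : HasThetaCircRep (FUV U V)) :
    ¬(kEntry V = 0 ∧ kEntry U = 0) ∧ ∃ (φ : RatFunc ℂ) (u v : EuclideanSpace ℂ (Fin p)) (w ξ : ℂ)
      (H : Matrix (Fin p ⊕ Fin p) (Fin p ⊕ Fin p) ℂ), φ ≠ 0 ∧ IsThetaParam u v w ξ H ∧
      chainMat V U = φ • Theta u v w ξ H := by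
  obtain ⟨u, v, w, ξ, H, hpar, hr⟩ := h
  have hk : ¬(kEntry U = 0 ∧ kEntry V = 0) := fun h0 =>
    not_representedBy_of_kEntry_eq_zero hV h0.1 h0.2 (isUnit_circ hpar.isUnit_Theta) hr
  obtain ⟨φ, hφ, he⟩ := eq_smul_of_representedBy hp (representedBy_chainMat hU hV hk) hr
    (isUnit_circ hpar.isUnit_Theta)
  refine ⟨fun h0 => hk h0.symm, substInvHom φ, u, v, w, ξ, H, (map_ne_zero _).2 hφ, hpar, ?_⟩
  rw [← circ_chainMat, he, circ_smul, circ_circ]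

theorem hasThetaRep_iff_hasThetaCircRep
    {F : RatMat (Fin 1) (Fin 1) → RatMat (Fin 1) (Fin 1)} :
    HasThetaRep F ↔ HasThetaCircRep F := by
  constructor
  · rintro ⟨u, v, w, ξ, H, hpar, hr⟩
    obtain ⟨φ, u', v', w', ξ', H', hφ, hpar', he⟩ := exists_circ_Theta_eq_smul hpar
    refine ⟨u', v', w', ξ', H', hpar', ?_⟩
    have hφ' : substInvHom φ ≠ 0 := (map_ne_zero _).2 hφ
    have h1 : circ (Theta u' v' w' ξ' H') = (substInvHom φ)⁻¹ • Theta u v w ξ H := by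
      rw [← circ_circ (Theta u v w ξ H), he, circ_smul, smul_smul, inv_mul_cancel₀ hφ', one_smul]
    rw [h1]
    exact representedBy_smul (inv_ne_zero hφ') hr
  · rintro ⟨u, v, w, ξ, H, hpar, hr⟩
    obtain ⟨φ, u', v', w', ξ', H', hφ, hpar', he⟩ := exists_circ_Theta_eq_smul hpar
    refine ⟨u', v', w', ξ', H', hpar', ?_⟩
    have h1 : Theta u' v' w' ξ' H' = φ⁻¹ • circ (Theta u v w ξ H) := by
      rw [he, smul_smul, inv_mul_cancel₀ hφ, one_smul]
    rw [h1]
    exact representedBy_smul (inv_ne_zero hφ) hr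

end representability

end AllPass

theorem corollary6p3 (p : ℕ) (U V : Matrix (Fin (p + 1)) (Fin (p + 1)) ℂ)
    (hU : U ∈ Matrix.unitaryGroup (Fin (p + 1)) ℂ)
    (hV : V ∈ Matrix.unitaryGroup (Fin (p + 1)) ℂ) :
    (1 < p →
      (AllPass.HasThetaRep (AllPass.FUV U V) ↔ ‖AllPass.kEntry U‖ < ‖AllPass.kEntry V‖) ∧
      (AllPass.HasThetaCircRep (AllPass.FUV U V) ↔ ‖AllPass.kEntry V‖ < ‖AllPass.kEntry U‖)) ∧
    (p = 1 →
      (AllPass.HasThetaRep (AllPass.FUV U V) ↔ AllPass.HasThetaCircRep (AllPass.FUV U V)) ∧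
      (AllPass.HasThetaRep (AllPass.FUV U V) ↔ ‖AllPass.kEntry U‖ ≠ ‖AllPass.kEntry V‖)) := by
  refine ⟨fun hp => ⟨⟨fun h => ?_, AllPass.hasThetaRep_of_lt hU hV⟩,
    ⟨fun h => ?_, AllPass.hasThetaCircRep_of_lt hU hV⟩⟩, ?_⟩
  · obtain ⟨hk, φ, u, v, w, ξ, H, hφ, hpar, he⟩ :=
      h.exists_chainMat_eq_smul (zero_lt_one.trans hp) hU hV
    exact AllPass.norm_kEntry_lt_of_chainMat_eq_smul hp hk hφ hpar he
  · obtain ⟨hk, φ, u, v, w, ξ, H, hφ, hpar, he⟩ :=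
      h.exists_chainMat_eq_smul (zero_lt_one.trans hp) hU hV
    exact AllPass.norm_kEntry_lt_of_chainMat_eq_smul hp hk hφ hpar he
  · rintro rfl
    refine ⟨AllPass.hasThetaRep_iff_hasThetaCircRep, fun h => ?_, fun h => ?_⟩
    · obtain ⟨hk, φ, u, v, w, ξ, H, -, hpar, he⟩ := h.exists_chainMat_eq_smul one_pos hU hV
      exact AllPass.norm_kEntry_ne_of_chainMat_eq_smul hU hV hk hpar he
    · rcases h.lt_or_gt with h | h
      · exact AllPass.hasThetaRep_of_lt hU hV h
      · exact AllPass.hasThetaRep_iff_hasThetaCircRep.2 (AllPass.hasThetaCircRep_of_lt hU hV h)
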